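/- Let $(C,\otimes,\mathbf 1)$ be one of $(\mathbb{Z}\text{-Mod},\otimes,\mathbb{Z})$ (abelian groups), $(\mathbb{N}\text{-Mod},\otimes,\mathbb{N})$ (commutative monoids) or $(\mathrm{Sets},\times,*)$ (the case of $\mathbb{F}_1$). Let $Comm(C)$ be the category of commutative monoids in $C$ (commutative rings, commutative semirings, commutative monoids respectively), $\mathrm{Aff}_C=Comm(C)^{op}$, and for $A\in Comm(C)$ let $A\text{-Mod}$ be the category of $A$-modules in $C$ (modules, semimodules, sets with an action of $A$). A morphism $A\to B$ is a Zariski open $\mathrm{Spec}\,B\to\mathrm{Spec}\,A$ if it is an epimorphism in $Comm(C)$, is flat ($-\otimes_A B: A\text{-Mod}\to B\text{-Mod}$ commutes with finite limits) and is of finite presentation ($\mathrm{Hom}(B,-)$ commutes with filtered colimits of objects under $A$). A family of Zariski opens $\mathrm{Spec}\,A_i\to\mathrm{Spec}\,A$ is a covering if the functors $-\otimes_A A_j$ are jointly conservative for $j$ in some finite subset of the indices. These coverings define the Zariski topology on $\mathrm{Aff}_C$; sheaves are taken with respect to it. A subsheaf of an affine scheme $X$ is open if it is the image of $\coprod X_i\to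 X$ for a family of Zariski opens $X_i\to X$; a morphism of sheaves $F\to G$ is an open immersion if for all affine $X\to G$ the projection $F\times_G X\to X$ is a monomorphism with open image; a sheaf $F$ is a scheme over $C$ if there are affine schemes $X_i$ and open immersions $X_i\to F$ such that $\coprod X_i\to F$ is an epimorphism of sheaves. The base change functor $-\otimes_{\mathbb{N}}\mathbb{Z}$ (resp. $-\otimes_{\mathbb{F}_1}\mathbb{N}$) sends a sheaf $F$ to the sheaf associated with the presheaf $A\mapsto F(gA)$, where $gA$ is the commutative ring $A$ regarded as a semiring (resp. the multiplicative monoid of the semiring $A$), and $-\otimes_{\mathbb{F}_1}\mathbb{Z}$ is their composite. For an integer $n\ge 0$ let $GL_{n,C}$ be the functor sending $A\in Comm(C)$ to the group of automorphisms of the free $A$-module $\coprod_{i=1}^n A$ of rank $n$, and write $GL_{n,\mathbb{Z}}$, $GL_{n,\mathbb{N}}$, $GL_{n,\mathbb{F}_1}$ in the three cases. These functors are sheaves of groups, and: 1. $GL_{n,\mathbb{Z}}$ and $GL_{n,\mathbb{N}}$ are representable by affine schemes over $\mathbb{Z}$ and over $\mathbb{N}$ respectively, and $GL_{n,\mathbb{F}_1}$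 is a scheme over $\mathbb{F}_1$. 2. The natural morphism $GL_{n,\mathbb{N}}\otimes_{\mathbb{N}}\mathbb{Z}\to GL_{n,\mathbb{Z}}$ (induced by regarding, for a commutative ring $A$, an automorphism of the semimodule $A^n$ as an automorphism of the module $A^n$) is an isomorphism, of sheaves of sets and of sheaves of groups. 3. $GL_{n,\mathbb{F}_1}\otimes_{\mathbb{F}_1}\mathbb{Z}$ is a scheme over $\mathbb{Z}$, isomorphic, as a sheaf of sets and as a sheaf of groups, to the semidirect product $\mathbb{G}_m^n\rtimes\Sigma_n$ of the constant group scheme $\Sigma_n$ by $\mathbb{G}_m^n$, where $\Sigma_n$ permutes the factors. 4. $GL_{n,\mathbb{Z}}(\mathbb{Z})$ is the group $GL_n(\mathbb{Z})$ of invertible integral $n\times n$ matrices, acting on $\mathbb{Z}^n$; and $GL_{n,\mathbb{N}}(\mathbb{N})$ and $GL_{n,\mathbb{F}_1}(\mathbb{F}_1)$ are both the symmetric group $\Sigma_n$, acting by permutation of the standard basis. -/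

import Mathlib

open CategoryTheory Opposite Limits

universe u v v' w

/-! ### Relative schemes

`𝓒` is the category `Comm(C)` of commutative monoids of the base `(C, ⊗, 1)`; the category of
affine schemes is `𝓒ᵒᵖ`, and `Spec A` is `op A`. -/

/-- The categories of modules `A-Mod`, for `A` in `𝓒`, with the extension of scalars functors
`- ⊗_A B`. -/
structure ModuleSystem (𝓒 : Type v) [Category.{u} 𝓒] where
  Mod : 𝓒 → Type v
  cat : ∀ A, Category.{u} (Mod A)
  extend : ∀ {A B : 𝓒}, (A ⟶ B) → (Mod A ⥤ Mod B)

attribute [instance] ModuleSystem.cat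

/-- `A ⟶ B` is of finite presentation: `Hom(B, -)` on the category of objects under `A` commutes
with filtered colimits. -/
def IsFinitelyPresented {𝓒 : Type v} [Category.{u} 𝓒] {A B : 𝓒} (φ : A ⟶ B) : Prop :=
  PreservesFilteredColimitsOfSize.{u, u} (coyoneda.obj (op (Under.mk φ)))

namespace ModuleSystem

variable {𝓒 : Type v} [Category.{u} 𝓒] (S : ModuleSystem 𝓒)

/-- `A ⟶ B` is flat: `- ⊗_A B` commutes with finite limits. -/
def IsFlat {A B : 𝓒} (φ : A ⟶ B) : Prop :=
  PreservesFiniteLimits (S.extend φ)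

/-- `Spec B ⟶ Spec A` is a Zariski open (morphism of affine schemes). -/
structure IsZariskiOpen {A B : 𝓒} (φ : A ⟶ B) : Prop where
  epi : Epi φ
  flat : S.IsFlat φ
  finitelyPresented : IsFinitelyPresented φ

/-- The family of functors `- ⊗_A B j` is jointly conservative. -/
def JointlyConservative {A : 𝓒} {J : Type} {B : J → 𝓒} (φ : ∀ j, A ⟶ B j) : Prop :=
  ∀ ⦃M N : S.Mod A⦄ (f : M ⟶ N), (∀ j, IsIso ((S.extend (φ j)).map f)) → IsIso f

/-- A Zariski covering of `X`: a family of Zariski opens having a finite subfamily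
along which the extensions of scalars are jointly conservative. -/
structure IsZariskiCovering {X : 𝓒ᵒᵖ} (R : Presieve X) : Prop where
  isZariskiOpen : ∀ ⦃Y : 𝓒ᵒᵖ⦄ (f : Y ⟶ X), R f → S.IsZariskiOpen f.unop
  exists_finite : ∃ (m : ℕ) (Y : Fin m → 𝓒ᵒᵖ) (f : ∀ j, Y j ⟶ X),
    (∀ j, R (f j)) ∧ S.JointlyConservative (fun j => (f j).unop)

/-- The Zariski topology on the category of affine schemes: the Grothendieck topology generated by
the Zariski coverings. -/
def zariskiTopology : GrothendieckTopology 𝓒ᵒᵖ :=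
  Precoverage.toGrothendieck ⟨fun X => {R : Presieve X | S.IsZariskiCovering R}⟩

/-- A subsheaf of an affine scheme `X`, seen as a sieve on `X`, is a Zariski open of `X` if it is
the image of the morphism of sheaves `∐ X i ⟶ X` for some family of Zariski opens `X i ⟶ X` of
affine schemes. The image sheaf is the closure of the sieve generated by the family. -/
def IsZariskiOpenSieve {X : 𝓒ᵒᵖ} (U : Sieve X) : Prop :=
  ∃ R : Presieve X, (∀ ⦃Y : 𝓒ᵒᵖ⦄ (f : Y ⟶ X), R f → S.IsZariskiOpen f.unop) ∧
    U = S.zariskiTopology.close (Sieve.generate R)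

/-- A morphism `F ⟶ G` of sheaves is a Zariski open immersion: for every affine scheme `X`
and every `x : X ⟶ G`, i.e. `x ∈ G(X)`, the projection `F ×_G X ⟶ X` is a monomorphism whose image
is a Zariski open of `X`. As `F ×_G X` consists of the pairs `(s, t)` with
`p s = t^* x`, the projection is a monomorphism for all `X` and `x` if and only if `p` is
injective, and its image is then the sieve of all `t : T ⟶ X` for which `t^* x` is in
the image of `p`. -/
structure IsOpenImmersion {F G : 𝓒ᵒᵖᵒᵖ ⥤ Type w} (p : F ⟶ G) : Prop where
  injective : ∀ T : 𝓒ᵒᵖᵒᵖ, Function.Injective (p.app T)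
  isOpen : ∀ (X : 𝓒ᵒᵖ) (x : G.obj (op X)),
    S.IsZariskiOpenSieve ((Subfunctor.range p).sieveOfSection x)

end ModuleSystem

/-- The sheaf of sets represented by `Spec A`, with values in the larger universe. -/
abbrev specSheaf {𝓒 : Type (u + 1)} [Category.{u} 𝓒] (A : 𝓒) : 𝓒ᵒᵖᵒᵖ ⥤ Type (u + 1) :=
  uliftYoneda.{u + 1}.obj (op A)

/-- `F` is represented by an affine scheme. -/
def IsAffineScheme {𝓒 : Type (u + 1)} [Category.{u} 𝓒] (F : 𝓒ᵒᵖᵒᵖ ⥤ Type (u + 1)) : Prop :=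
  ∃ A : 𝓒, Nonempty (F ≅ specSheaf A)

/-- `F` is a relative scheme: a Zariski sheaf with a family of Zariski open immersions
`p i : Spec (A i) ⟶ F` such that `∐ Spec (A i) ⟶ F` is an epimorphism of sheaves, i.e. every section
of `F` lifts locally to one of the `Spec (A i)`. -/
def IsRelativeScheme {𝓒 : Type (u + 1)} [Category.{u} 𝓒] (S : ModuleSystem 𝓒)
    (F : 𝓒ᵒᵖᵒᵖ ⥤ Type (u + 1)) : Prop :=
  Presheaf.IsSheaf S.zariskiTopology F ∧
  ∃ (I : Type u) (A : I → 𝓒) (p : ∀ i, specSheaf (A i) ⟶ F),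
    (∀ i, S.IsOpenImmersion (p i)) ∧
    ∀ (T : 𝓒ᵒᵖ) (s : F.obj (op T)),
      (⨆ i, (Subfunctor.range (p i)).sieveOfSection s) ∈ S.zariskiTopology T

/-! ### The three bases -/

/-- The base `ℤ-Mod`: commutative rings and their modules. -/
noncomputable def modulesZ : ModuleSystem CommRingCat.{u} where
  Mod A := ModuleCat.{u} A
  cat _ := inferInstance
  extend φ := ModuleCat.extendScalars φ.hom

/-- Extension of scalars `M ↦ B ⊗[A] M` for semimodules over commutative semirings. -/
noncomputable def semimoduleExtend {A B : Type u} [CommSemiring A] [CommSemiring B] (φ : A →+* B) :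
    SemimoduleCat.{u} A ⥤ SemimoduleCat.{u} B :=
  letI := φ.toAlgebra
  { obj := fun M => SemimoduleCat.of B (TensorProduct A B M)
    map := fun l => SemimoduleCat.ofHom (LinearMap.baseChange B l.hom)
    map_id := fun M => by
      ext : 1
      exact LinearMap.baseChange_id
    map_comp := fun f g => by
      ext : 1
      exact LinearMap.baseChange_comp _ _ }

/-- The base `ℕ-Mod`: commutative semirings and their semimodules. -/
noncomputable def modulesN : ModuleSystem CommSemiRingCat.{u} where
  Mod A := SemimoduleCat.{u} A
  cat _ := inferInstance
  extend φ := semimoduleExtend φ.hom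

/-- The set `B ⊗_A X`, for `φ : A → B` a morphism of commutative monoids and `X` a set with an
action of `A`: the quotient of `B × X` by `(b * φ a, x) ∼ (b, a • x)`. -/
def ActTensor {A B : Type u} [CommMonoid A] [CommMonoid B] (φ : A →* B) (X : Action (Type u) A) :
    Type u :=
  Quot (fun p q : B × X.V => ∃ (a : A) (b : B) (x : X.V), p = (b * φ a, x) ∧ q = (b, X.ρ a x))

/-- `B` acts on `B ⊗_A X` by multiplication on the first factor. -/
instance {A B : Type u} [CommMonoid A] [CommMonoid B] (φ : A →* B) (X : Action (Type u) A) :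
    MulAction B (ActTensor φ X) where
  smul c := Quot.map (fun p => (c * p.1, p.2)) (by
    rintro _ _ ⟨a, b, x, rfl, rfl⟩
    exact ⟨a, c * b, x, by simp [mul_assoc], rfl⟩)
  one_smul := by
    rintro ⟨b, x⟩
    exact congrArg (Quot.mk _) (by simp)
  mul_smul := by
    rintro c d ⟨b, x⟩
    exact congrArg (Quot.mk _) (by simp [mul_assoc])

/-- Extension of scalars `X ↦ B ⊗_A X` for sets with a monoid action. -/
def actExtend {A B : Type u} [CommMonoid A] [CommMonoid B] (φ : A →* B) :
    Action (Type u) A ⥤ Action (Type u) B where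
  obj X := Action.ofMulAction B (ActTensor φ X)
  map {X Y} f :=
    { hom := ↾(Quot.map (fun p => (p.1, f.hom p.2)) (by
        rintro _ _ ⟨a, b, x, rfl, rfl⟩
        exact ⟨a, b, f.hom x, rfl,
          Prod.ext rfl (ConcreteCategory.congr_hom (f.comm a) x)⟩) :
          ActTensor φ X → ActTensor φ Y)
      comm := fun c => by
        ext z
        obtain ⟨b, x⟩ := z
        rfl }
  map_id X := by
    ext z
    obtain ⟨b, x⟩ := z
    rfl
  map_comp f g := by
    ext z
    obtain ⟨b, x⟩ := z
    rfl

/-- The base `𝔽₁-Mod = Sets`: commutative monoids and the sets on which they act. -/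
def modulesF : ModuleSystem CommMonCat.{u} where
  Mod A := Action (Type u) A
  cat _ := inferInstance
  extend φ := actExtend φ.hom

/-- The Zariski topologies on affine schemes over `ℤ`, `ℕ` and `𝔽₁`. -/
noncomputable abbrev zarZ : GrothendieckTopology CommRingCat.{u}ᵒᵖ :=
  modulesZ.zariskiTopology

noncomputable abbrev zarN : GrothendieckTopology CommSemiRingCat.{u}ᵒᵖ :=
  modulesN.zariskiTopology

abbrev zarF : GrothendieckTopology CommMonCat.{u}ᵒᵖ :=
  modulesF.zariskiTopology

/-! ### Base change -/

/-- Filtered colimits of groups over the coverings of an affine scheme exist, so that presheaves of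
groups have associated sheaves. -/
instance grpCat_hasColimitsOfShape_cover {𝓒 : Type (u + 1)} [Category.{u} 𝓒]
    (J : GrothendieckTopology 𝓒ᵒᵖ) (X : 𝓒ᵒᵖ) :
    HasColimitsOfShape (J.Cover X)ᵒᵖ GrpCat.{u + 1} where
  has_colimit F := ⟨⟨⟨GrpCat.FilteredColimits.colimitCocone.{u + 1, u + 1} F,
    GrpCat.FilteredColimits.colimitCoconeIsColimit F⟩⟩⟩

/-- For `g : Comm(D) ⥤ Comm(C)` induced by the right adjoint of a symmetric monoidal functor
`C ⥤ D`, the base change functor on sheaves sends `F` to the sheaf associated with the presheaf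
`X ↦ F(g X)`. -/
noncomputable def sheafBaseChange {𝓒 𝓓 : Type (u + 1)} [Category.{u} 𝓒] [Category.{u} 𝓓]
    (g : 𝓓 ⥤ 𝓒) (J : GrothendieckTopology 𝓒ᵒᵖ) (K : GrothendieckTopology 𝓓ᵒᵖ)
    (E : Type w) [Category.{v} E] [HasWeakSheafify K E] : Sheaf J E ⥤ Sheaf K E :=
  sheafToPresheaf J E ⋙ (Functor.whiskeringLeft _ _ E).obj g.op.op ⋙ presheafToSheaf K E

/-- The morphism from the base change of `P` to a sheaf `Q` induced, through the universal property
of the associated sheaf, by a morphism of presheaves `P(g X) ⟶ Q(X)`. -/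
noncomputable def sheafBaseChangeDesc {𝓒 𝓓 : Type (u + 1)} [Category.{u} 𝓒] [Category.{u} 𝓓]
    (g : 𝓓 ⥤ 𝓒) {J : GrothendieckTopology 𝓒ᵒᵖ} {K : GrothendieckTopology 𝓓ᵒᵖ}
    {E : Type w} [Category.{v} E] [HasWeakSheafify K E] {P : Sheaf J E} {Q : Sheaf K E}
    (α : g.op.op ⋙ P.obj ⟶ Q.obj) : (sheafBaseChange g J K E).obj P ⟶ Q :=
  ((sheafificationAdjunction K E).homEquiv _ _).symm α

/-- `- ⊗_ℕ ℤ`, along the inclusion of commutative rings in commutative semirings. -/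
noncomputable def baseChangeNZ (E : Type w) [Category.{v} E] [HasWeakSheafify zarZ.{u} E] :
    Sheaf zarN.{u} E ⥤ Sheaf zarZ.{u} E :=
  sheafBaseChange (forget₂ CommRingCat.{u} CommSemiRingCat.{u}) zarN zarZ E

/-- `- ⊗_{𝔽₁} ℕ`, along the functor sending a commutative semiring to its multiplicative monoid. -/
noncomputable def baseChangeFN (E : Type w) [Category.{v} E] [HasWeakSheafify zarN.{u} E] :
    Sheaf zarF.{u} E ⥤ Sheaf zarN.{u} E :=
  sheafBaseChange (forget₂ CommSemiRingCat.{u} CommMonCat.{u}) zarF zarN E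

/-- `- ⊗_{𝔽₁} ℤ`, the composite of `- ⊗_{𝔽₁} ℕ` and `- ⊗_ℕ ℤ`. -/
noncomputable def baseChangeFZ (E : Type w) [Category.{v} E] [HasWeakSheafify zarN.{u} E]
    [HasWeakSheafify zarZ.{u} E] : Sheaf zarF.{u} E ⥤ Sheaf zarZ.{u} E :=
  baseChangeFN E ⋙ baseChangeNZ E

/-! ### The functors `GL_n` -/

/-- A functor from `𝓒` to groups, as a presheaf of groups on `𝓒ᵒᵖ` in the larger universe. -/
abbrev groupPresheaf {𝓒 : Type (u + 1)} [Category.{u} 𝓒] (F : 𝓒 ⥤ GrpCat.{u}) :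
    𝓒ᵒᵖᵒᵖ ⥤ GrpCat.{u + 1} :=
  unopUnop 𝓒 ⋙ F ⋙ GrpCat.uliftFunctor.{u + 1, u}

/-- The linear automorphisms of the free module of rank `n`. -/
abbrev LinAut (n : ℕ) (A : Type u) [CommSemiring A] : Type u :=
  LinearMap.GeneralLinearGroup A (Fin n → A)

/-- Extension of scalars for automorphisms of free modules, i.e. application of `φ` to the entries
of the matrix. -/
def LinAut.map (n : ℕ) {A B : Type u} [CommSemiring A] [CommSemiring B] (φ : A →+* B) :
    LinAut n A →* LinAut n B :=
  Units.map <| (Matrix.toLinAlgEquiv' (R := B) (n := Fin n)).toRingEquiv.toRingHom.toMonoidHom.comp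
    ((φ.mapMatrix (m := Fin n)).toMonoidHom.comp
      (LinearMap.toMatrixAlgEquiv' (R := A) (n := Fin n)).toRingEquiv.toRingHom.toMonoidHom)

theorem LinAut.map_id (n : ℕ) (A : Type u) [CommSemiring A] :
    LinAut.map n (RingHom.id A) = MonoidHom.id _ := by
  ext1 x
  apply Units.ext
  simp [LinAut.map]

theorem LinAut.map_comp (n : ℕ) {A B C : Type u} [CommSemiring A] [CommSemiring B] [CommSemiring C]
    (φ : A →+* B) (ψ : B →+* C) :
    LinAut.map n (ψ.comp φ) = (LinAut.map n ψ).comp (LinAut.map n φ) := by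
  ext1 x
  apply Units.ext
  simp [LinAut.map]

/-- `GL_{n,ℕ}`: a commutative semiring `A` is sent to the group `Aut(A^n)`. -/
def glN (n : ℕ) : CommSemiRingCat.{u} ⥤ GrpCat.{u} where
  obj A := GrpCat.of (LinAut n A)
  map φ := GrpCat.ofHom (LinAut.map n φ.hom)
  map_id A := by
    ext1
    exact LinAut.map_id n A
  map_comp φ ψ := by
    ext1
    exact LinAut.map_comp n φ.hom ψ.hom

/-- `GL_{n,ℤ}`: a commutative ring `A` is sent to the group `Aut(A^n)`. -/
def glZ (n : ℕ) : CommRingCat.{u} ⥤ GrpCat.{u} where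
  obj A := GrpCat.of (LinAut n A)
  map φ := GrpCat.ofHom (LinAut.map n φ.hom)
  map_id A := by
    ext1
    exact LinAut.map_id n A
  map_comp φ ψ := by
    ext1
    exact LinAut.map_comp n φ.hom ψ.hom

/-- The natural morphism from the restriction of `GL_{n,ℕ}` to commutative rings to `GL_{n,ℤ}`:
an automorphism of the semimodule `A^n` is sent to the same automorphism of the module `A^n`. -/
def glNToGlZ (n : ℕ) :
    (forget₂ CommRingCat.{u} CommSemiRingCat.{u}).op.op ⋙ groupPresheaf (glN.{u} n) ⟶
      groupPresheaf (glZ.{u} n) where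
  app A := GrpCat.ofHom (MonoidHom.id (ULift.{u + 1} (LinAut n A.unop.unop)))

/-- The automorphisms of the free `A`-set `∐_{i = 1, …, n} A` of rank `n`, for a commutative
monoid `A`: the permutations commuting with the action of `A`. -/
def actAut (n : ℕ) (A : Type u) [CommMonoid A] : Subgroup (Equiv.Perm (Σ _ : Fin n, A)) where
  carrier := {e | ∀ (a : A) (x : Σ _ : Fin n, A), e (a • x) = a • e x}
  mul_mem' {e f} he hf a x := by
    simp only [Set.mem_ofPred_eq] at he hf
    rw [Equiv.Perm.mul_apply, hf, he, Equiv.Perm.mul_apply]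
  one_mem' _ _ := rfl
  inv_mem' {e} he a x := by
    simp only [Set.mem_ofPred_eq] at he
    rw [Equiv.Perm.inv_eq_iff_eq, he, ← Equiv.Perm.mul_apply, mul_inv_cancel, Equiv.Perm.one_apply]

theorem actAut.apply_mk {n : ℕ} {A : Type u} [CommMonoid A] (e : actAut n A) (i : Fin n) (a : A) :
    e.1 ⟨i, a⟩ = ⟨(e.1 ⟨i, 1⟩).1, a * (e.1 ⟨i, 1⟩).2⟩ := by
  have h := e.2 a ⟨i, 1⟩
  have h' : (a • (⟨i, 1⟩ : Σ _ : Fin n, A)) = ⟨i, a⟩ :=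
    Sigma.ext rfl (heq_of_eq (mul_one a))
  rw [h'] at h
  exact h

/-- Extension of scalars of an equivariant map `∐ A → ∐ A` along `φ : A → B`. -/
def actAut.mapFun (n : ℕ) {A B : Type u} [CommMonoid A] [CommMonoid B] (φ : A →* B)
    (e : actAut n A) (x : Σ _ : Fin n, B) : Σ _ : Fin n, B :=
  ⟨(e.1 ⟨x.1, 1⟩).1, x.2 * φ (e.1 ⟨x.1, 1⟩).2⟩

theorem actAut.mapFun_mul (n : ℕ) {A B : Type u} [CommMonoid A] [CommMonoid B] (φ : A →* B)
    (e f : actAut n A) (x : Σ _ : Fin n, B) :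
    actAut.mapFun n φ (e * f) x = actAut.mapFun n φ e (actAut.mapFun n φ f x) := by
  have h : (e * f).1 ⟨x.1, 1⟩ = ⟨(e.1 ⟨(f.1 ⟨x.1, 1⟩).1, 1⟩).1,
      (f.1 ⟨x.1, 1⟩).2 * (e.1 ⟨(f.1 ⟨x.1, 1⟩).1, 1⟩).2⟩ :=
    actAut.apply_mk e (f.1 ⟨x.1, 1⟩).1 (f.1 ⟨x.1, 1⟩).2
  simp only [actAut.mapFun, h, map_mul, mul_assoc]

theorem actAut.mapFun_one (n : ℕ) {A B : Type u} [CommMonoid A] [CommMonoid B] (φ : A →* B)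
    (x : Σ _ : Fin n, B) : actAut.mapFun n φ 1 x = x := by
  simp [actAut.mapFun]

/-- Extension of scalars for automorphisms of free sets with a monoid action. -/
def actAut.map (n : ℕ) {A B : Type u} [CommMonoid A] [CommMonoid B] (φ : A →* B) :
    actAut n A →* actAut n B where
  toFun e := ⟨⟨actAut.mapFun n φ e, actAut.mapFun n φ e⁻¹,
      fun x => by rw [← actAut.mapFun_mul, inv_mul_cancel, actAut.mapFun_one],
      fun x => by rw [← actAut.mapFun_mul, mul_inv_cancel, actAut.mapFun_one]⟩,
    fun b x => Sigma.ext rfl (heq_of_eq (mul_assoc _ _ _))⟩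
  map_one' := Subtype.ext (Equiv.ext (actAut.mapFun_one n φ))
  map_mul' e f := Subtype.ext (Equiv.ext (actAut.mapFun_mul n φ e f))

/-- `GL_{n,𝔽₁}`: a commutative monoid `A` is sent to the group `Aut(∐_{i = 1, …, n} A)`. -/
def glF (n : ℕ) : CommMonCat.{u} ⥤ GrpCat.{u} where
  obj A := GrpCat.of (actAut n A)
  map φ := GrpCat.ofHom (actAut.map n φ.hom)
  map_id A := by
    apply GrpCat.hom_ext
    refine MonoidHom.ext fun e => Subtype.ext (Equiv.ext ?_)
    rintro ⟨i, a⟩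
    exact (actAut.apply_mk e i a).symm
  map_comp {A B C} φ ψ := by
    apply GrpCat.hom_ext
    refine MonoidHom.ext fun e => Subtype.ext (Equiv.ext ?_)
    rintro ⟨i, c⟩
    refine Sigma.ext rfl (heq_of_eq ?_)
    change c * ψ.hom (φ.hom _) = c * ψ.hom (1 * φ.hom _)
    rw [one_mul]

/-! ### The semidirect product of `Σ_n` and `𝔾_m^n` over `ℤ` -/

/-- The points with values in a commutative ring `A` of the constant group scheme associated
with a finite group `G`: the ring morphisms `ℤ^G → A`, i.e. the locally constant functions
`Spec A → G`, i.e. the complete families of orthogonal idempotents of `A` indexed by `G`. -/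
@[ext]
structure ConstGroup (G : Type) [Group G] [Fintype G] (A : Type u) [CommRing A] : Type u where
  fam : G → A
  complete : CompleteOrthogonalIdempotents fam

namespace ConstGroup

variable {G : Type} [Group G] [Fintype G] {A B : Type u} [CommRing A] [CommRing B]

theorem sum_mul_sum (e : ConstGroup G A) (x y : G → A) :
    (∑ g, e.fam g * x g) * (∑ g, e.fam g * y g) = ∑ g, e.fam g * (x g * y g) := by
  classical
  rw [Finset.sum_mul]
  refine Finset.sum_congr rfl fun g _ => ?_
  rw [Finset.mul_sum, Finset.sum_eq_single g]
  · have := (e.complete.idem g).eq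
    linear_combination x g * y g * this
  · intro h _ hne
    have := e.complete.ortho hne.symm
    simp only at this
    linear_combination x g * y h * this
  · simp

theorem sum_eq_one (e : ConstGroup G A) : ∑ g, e.fam g = 1 := e.complete.complete

/-- The product of two families is their convolution product. -/
instance : Mul (ConstGroup G A) where
  mul e f := ⟨fun g => ∑ h, e.fam h * f.fam (h⁻¹ * g), by
    refine ⟨⟨fun g => ?_, fun g g' hne => ?_⟩, ?_⟩
    · change _ * _ = _
      rw [sum_mul_sum]
      exact Finset.sum_congr rfl fun h _ => by rw [(f.complete.idem (h⁻¹ * g)).eq]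
    · change _ * _ = _
      rw [sum_mul_sum]
      refine Finset.sum_eq_zero fun h _ => ?_
      have := f.complete.ortho (i := h⁻¹ * g) (j := h⁻¹ * g') (by simpa using hne)
      simp only at this
      rw [this, mul_zero]
    · rw [Finset.sum_comm]
      have : ∀ h, ∑ g, e.fam h * f.fam (h⁻¹ * g) = e.fam h := fun h => by
        rw [← Finset.mul_sum, show ∑ g, f.fam (h⁻¹ * g) = 1 from
          (Equiv.sum_comp (Equiv.mulLeft h⁻¹) f.fam).trans f.sum_eq_one, mul_one]
      simp only [this, e.sum_eq_one]⟩

theorem mul_apply (e f : ConstGroup G A) (g : G) :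
    (e * f).fam g = ∑ h, e.fam h * f.fam (h⁻¹ * g) := rfl

open Classical in
noncomputable instance : One (ConstGroup G A) where
  one := ⟨Pi.single 1 1, by
    refine ⟨⟨fun g => ?_, fun g g' hne => ?_⟩, ?_⟩
    · by_cases h : g = 1
      · subst h
        simp [IsIdempotentElem]
      · simp [IsIdempotentElem, h]
    · by_cases h : g = 1
      · subst h
        simp [Ne.symm hne]
      · simp [h]
    · simp⟩

open Classical in
theorem one_apply (g : G) : (1 : ConstGroup G A).fam g = if g = 1 then 1 else 0 :=
  Pi.single_apply (1 : G) (1 : A) g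

instance : Inv (ConstGroup G A) where
  inv e := ⟨fun g => e.fam g⁻¹, by
    refine ⟨⟨fun g => e.complete.idem g⁻¹, fun g g' hne => ?_⟩, ?_⟩
    · exact e.complete.ortho (i := g⁻¹) (j := g'⁻¹) (by simpa using hne)
    · exact (Equiv.sum_comp (Equiv.inv G) e.fam).trans e.sum_eq_one⟩

theorem inv_apply (e : ConstGroup G A) (g : G) : e⁻¹.fam g = e.fam g⁻¹ := rfl

/-- The key computation with the convolution product. -/
theorem sum_mul_apply (e f : ConstGroup G A) (x : G → A) :
    ∑ g, (e * f).fam g * x g = ∑ h, e.fam h * ∑ k, f.fam k * x (h * k) := by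
  simp only [mul_apply, Finset.sum_mul]
  rw [Finset.sum_comm]
  refine Finset.sum_congr rfl fun h _ => ?_
  rw [Finset.mul_sum, ← Equiv.sum_comp (Equiv.mulLeft h)]
  exact Finset.sum_congr rfl fun k _ => by simp [mul_assoc]

noncomputable instance : Group (ConstGroup G A) where
  mul_assoc e f k := by
    ext g : 2
    rw [mul_apply, sum_mul_apply, mul_apply]
    simp only [mul_apply, mul_inv_rev, mul_assoc]
  one_mul e := by
    classical
    ext g : 2
    simp [mul_apply, one_apply]
  mul_one e := by
    classical
    ext g : 2
    simp [mul_apply, one_apply, inv_mul_eq_one]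
  inv_mul_cancel e := by
    classical
    ext g : 2
    rw [mul_apply, ← Equiv.sum_comp (Equiv.inv G)]
    simp only [Equiv.inv_apply, inv_apply, inv_inv, one_apply]
    split_ifs with hg
    · subst hg
      simp only [mul_one]
      rw [← e.sum_eq_one]
      exact Finset.sum_congr rfl fun h _ => (e.complete.idem h).eq
    · refine Finset.sum_eq_zero fun h _ => e.complete.ortho ?_
      simpa using hg

/-- Functoriality in the ring. -/
def map (G : Type) [Group G] [Fintype G] (φ : A →+* B) : ConstGroup G A →* ConstGroup G B where
  toFun e := ⟨fun g => φ (e.fam g), e.complete.map φ⟩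
  map_one' := by
    classical
    ext g : 2
    change φ ((1 : ConstGroup G A).fam g) = _
    simp only [one_apply]
    split_ifs <;> simp
  map_mul' e f := by
    ext g : 2
    change φ (∑ h, e.fam h * f.fam (h⁻¹ * g)) = ∑ h, φ (e.fam h) * φ (f.fam (h⁻¹ * g))
    simp

/-- The action of the constant group scheme `Σ_n` on `𝔾_m^n` permuting the factors. On
the open and closed subscheme where `e` takes the value `σ` it sends `t` to
`i ↦ t (σ⁻¹ i)`. -/
def permute {n : ℕ} (e : ConstGroup (Equiv.Perm (Fin n)) A) (t : Fin n → Aˣ) : Fin n → Aˣ :=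
  fun i =>
    { val := ∑ σ, e.fam σ * (t (σ⁻¹ i) : A)
      inv := ∑ σ, e.fam σ * ((t (σ⁻¹ i))⁻¹ : Aˣ)
      val_inv := by simp [sum_mul_sum, e.sum_eq_one]
      inv_val := by simp [sum_mul_sum, e.sum_eq_one] }

theorem permute_apply {n : ℕ} (e : ConstGroup (Equiv.Perm (Fin n)) A) (t : Fin n → Aˣ)
    (i : Fin n) : (e.permute t i : A) = ∑ σ, e.fam σ * (t (σ⁻¹ i) : A) := rfl

noncomputable instance {n : ℕ} : MulDistribMulAction (ConstGroup (Equiv.Perm (Fin n)) A) (Fin n → Aˣ) where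
  smul := permute
  one_smul t := by
    classical
    funext i
    apply Units.ext
    change (permute 1 t i : A) = _
    simp only [permute_apply, one_apply, ite_mul, one_mul, zero_mul, Finset.sum_ite_eq',
      Finset.mem_univ, if_true]
    rfl
  mul_smul e f t := by
    funext i
    apply Units.ext
    change (permute (e * f) t i : A) = (permute e (permute f t) i : A)
    simp only [permute_apply, sum_mul_apply, mul_inv_rev, Equiv.Perm.mul_apply]
  smul_one e := by
    funext i
    apply Units.ext
    change (permute e 1 i : A) = _
    simp [permute_apply, e.sum_eq_one]
  smul_mul e s t := by
    funext i
    apply Units.ext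
    change (permute e (s * t) i : A) = (permute e s i : A) * (permute e t i : A)
    simp [permute_apply, sum_mul_sum]

end ConstGroup

/-- The group of points with values in `A` of the semidirect product `𝔾_m^n ⋊ Σ_n` over `ℤ`. -/
noncomputable abbrev SemidirectPoints (n : ℕ) (A : Type u) [CommRing A] : Type u :=
  (Fin n → Aˣ) ⋊[MulDistribMulAction.toMulAut (ConstGroup (Equiv.Perm (Fin n)) A) (Fin n → Aˣ)]
    ConstGroup (Equiv.Perm (Fin n)) A

/-- The group functor `𝔾_m^n ⋊ Σ_n` on commutative rings. -/
noncomputable def semidirectZ (n : ℕ) : CommRingCat.{u} ⥤ GrpCat.{u} where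
  obj A := GrpCat.of (SemidirectPoints n A)
  map {A B} φ := GrpCat.ofHom <| SemidirectProduct.map
    ((Units.map φ.hom.toMonoidHom).compLeft (Fin n))
    (ConstGroup.map (Equiv.Perm (Fin n)) φ.hom) (fun e => by
      refine MonoidHom.ext fun t => funext fun i => Units.ext ?_
      change φ.hom (e.permute t i : A) =
        ((ConstGroup.map (Equiv.Perm (Fin n)) φ.hom e).permute _ i : B)
      simp only [ConstGroup.permute_apply, map_sum, map_mul]
      rfl)
  map_id A := by
    apply GrpCat.hom_ext
    exact MonoidHom.ext fun x => SemidirectProduct.ext rfl rfl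
  map_comp φ ψ := by
    apply GrpCat.hom_ext
    exact MonoidHom.ext fun x => SemidirectProduct.ext rfl rfl

/-! ### The groups of points -/

/-- The value `G(A)` at `Spec A` of a presheaf of groups. -/
abbrev pointsAt {𝓒 : Type (u + 1)} [Category.{u} 𝓒] (F : 𝓒ᵒᵖᵒᵖ ⥤ GrpCat.{u + 1}) (A : 𝓒) :
    Type (u + 1) :=
  F.obj (op (op A))

/-- `ℤ` as an object of `Comm(ℤ-Mod)`. -/
abbrev baseZ : CommRingCat.{u} := CommRingCat.of (ULift.{u} ℤ)

/-- `ℕ` as an object of `Comm(ℕ-Mod)`. -/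
abbrev baseN : CommSemiRingCat.{u} := CommSemiRingCat.of (ULift.{u} ℕ)

/-- `𝔽₁`, the one-point monoid, as an object of `Comm(𝔽₁-Mod)`. -/
abbrev baseF : CommMonCat.{u} := CommMonCat.of PUnit.{u + 1}

/-! Over ℤ and ℕ, an automorphism of `A^n` is a pair of mutually inverse matrices, i.e. a solution
of polynomial equations with coefficients in ℕ. The universal solution lives in a quotient of a
polynomial semiring (`ringQuotHomEquiv`), and tensoring it with ℤ gives the universal solution among
rings. Affine schemes are sheaves by descent (`toDescentData_bijective`): conservativity allows the
map from a module to its descent data to be checked after tensoring with one member of the covering,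
where multiplication splits it, and flatness keeps the descent data a submodule. Only these two
consequences of being a covering are used, so one argument serves both bases.

Over 𝔽₁ the topology is trivial (`zarF_eq_bot`). A flat local morphism of monoids is bijective, so a
covering without isomorphisms would consist of morphisms each inverting some nonunit; the inclusion
of the nonunits in `A` would then become bijective over every member without being so itself. Hence
every presheaf is a sheaf. An automorphism of a free set is a permutation with `n` invertible
coefficients, so `GL_n` is a disjoint union of tori indexed by the permutations.

The base change from 𝔽₁ to ℤ passes through ℕ, so 𝔾_m^n ⋊ Σ_n is first built over semirings, a point
of Σ_n being a complete family of orthogonal idempotents. Monomial automorphisms give the points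
whose family is constant, and every point is locally of this form: the localizations at the
idempotents form a Zariski covering (`mem_zarN_of_idempotents`) on which the family becomes
constant. The comparison map is thus locally bijective with target an affine scheme, hence a sheaf,
and this identifies the associated sheaf. Restricting to rings changes neither 𝔾_m^n ⋊ Σ_n nor
`GL_n`, which yields the base changes to ℤ.

For the points over ℕ, sums cannot cancel, so an invertible matrix has a single nonzero entry in
each column (`exists_perm_of_mul_eq_one`). -/

open TensorProduct

/-! ### Generalities on the Zariski topology -/

namespace ModuleSystem

variable {𝓒 : Type v} [Category.{u} 𝓒] (S : ModuleSystem 𝓒)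

/-- A presheaf is a Zariski sheaf if it is a sheaf for all base changes of finite jointly
conservative families of Zariski opens. -/
theorem isSheaf_zariskiTopology_of_pushouts (P : 𝓒ᵒᵖᵒᵖ ⥤ Type w)
    (H : ∀ {A A' : 𝓒} (h : A ⟶ A') (m : ℕ) (B : Fin m → 𝓒) (φ : ∀ j, A ⟶ B j),
      (∀ j, S.IsZariskiOpen (φ j)) → S.JointlyConservative φ →
      ∃ (C : Fin m → 𝓒) (q : ∀ j, A' ⟶ C j) (r : ∀ j, B j ⟶ C j),
        (∀ j, IsPushout h (φ j) (q j) (r j)) ∧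
        ∀ x : ∀ j, P.obj (op (op (C j))),
          (∀ i j D (a : C i ⟶ D) (b : C j ⟶ D), q i ≫ a = q j ≫ b →
            P.map a.op.op (x i) = P.map b.op.op (x j)) →
          ∃! t : P.obj (op (op A')), ∀ j, P.map (q j).op.op t = x j) :
    Presieve.IsSheaf S.zariskiTopology P := by
  rw [zariskiTopology, Precoverage.isSheaf_toGrothendieck_iff]
  intro X Y f R hR
  obtain ⟨m, Yj, fj, hfj, hc⟩ := hR.exists_finite
  have hle : Sieve.generate (Presieve.ofArrows Yj fj) ≤ Sieve.generate R := by
    rw [Sieve.generate_le_iff]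
    rintro Z g ⟨j⟩
    exact Sieve.le_generate R _ _ (hfj j)
  -- It is enough to treat the sieve generated by the finite conservative subfamily, provided all
  -- its pullbacks are treated too.
  refine Presieve.isSheafFor_subsieve P
    (S := (Sieve.generate (Presieve.ofArrows Yj fj)).pullback f)
    (Sieve.pullback_monotone f hle) fun Z g => ?_
  rw [← Sieve.pullback_comp]
  obtain ⟨C, q, r, hpo, hx⟩ := H (g ≫ f).unop m (fun j => (Yj j).unop) (fun j => (fj j).unop)
    (fun j => hR.isZariskiOpen _ (hfj j)) hc
  -- Pushouts in `𝓒` are fibre products of affine schemes, so the pulled-back sieve is generated by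
  -- the base-changed family.
  have heq : (Sieve.generate (Presieve.ofArrows Yj fj)).pullback (g ≫ f) =
      Sieve.generate (Presieve.ofArrows (fun j => op (C j)) (fun j => (q j).op)) := by
    refine le_antisymm ?_ ?_
    · rintro W k ⟨_, a, _, ⟨j⟩, hk⟩
      have hk' : (g ≫ f).unop ≫ k.unop = (fj j).unop ≫ a.unop :=
        Quiver.Hom.op_inj hk.symm
      refine ⟨_, ((hpo j).desc k.unop a.unop hk').op, _, ⟨j⟩, ?_⟩
      apply Quiver.Hom.unop_inj
      exact (hpo j).inl_desc _ _ _
    · rw [Sieve.generate_le_iff]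
      rintro _ _ ⟨j⟩
      refine ⟨_, (r j).op, _, ⟨j⟩, ?_⟩
      apply Quiver.Hom.unop_inj
      exact (hpo j).w.symm
  rw [heq, ← Presieve.isSheafFor_iff_generate, Presieve.isSheafFor_arrows_iff]
  intro x hcompat
  exact hx x fun i j D a b hab => hcompat i j (op D) a.op b.op (congrArg Quiver.Hom.op hab)

/-- If every covering contains an isomorphism then the Zariski topology is trivial. -/
theorem zariskiTopology_eq_bot
    (H : ∀ {A : 𝓒} (m : ℕ) (B : Fin m → 𝓒) (φ : ∀ j, A ⟶ B j),
      (∀ j, S.IsZariskiOpen (φ j)) → S.JointlyConservative φ → ∃ j, IsIso (φ j)) :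
    S.zariskiTopology = ⊥ := by
  refine le_bot_iff.mp (Precoverage.toGrothendieck_le_iff_le_toPrecoverage.mpr ?_)
  intro X R hR
  obtain ⟨m, Y, f, hf, hc⟩ := hR.exists_finite
  obtain ⟨j, hj⟩ := H m _ _ (fun j => hR.isZariskiOpen _ (hf j)) hc
  rw [GrothendieckTopology.mem_toPrecoverage_iff, GrothendieckTopology.bot_covering,
    ← Sieve.id_mem_iff_eq_top]
  have : IsIso (f j) := (isIso_unop_iff (f j)).mp hj
  exact ⟨_, inv (f j), _, hf j, by simp⟩

/-- An epimorphism `A ⟶ B` is of finite presentation if it factors through some stage of every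
filtered colimit of objects under `A` whose colimit it factors through. -/
theorem _root_.IsFinitelyPresented.of_epi {A B : 𝓒} (φ : A ⟶ B) [Epi φ]
    (H : ∀ (J : Type u) [Category.{u} J] [IsFiltered J] (K : J ⥤ Under A) (c : Cocone K),
      IsColimit c → (Under.mk φ ⟶ c.pt) → ∃ j, Nonempty (Under.mk φ ⟶ K.obj j)) :
    IsFinitelyPresented φ where
  preserves_filtered_colimits J _ _ := ⟨fun {K} => ⟨fun {c} hc => by
    -- As `φ` is an epimorphism, there is at most one morphism from `B` to any object under `A`;
    -- only existence at a finite stage remains.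
    have hs : ∀ (X : Under A) (f g : Under.mk φ ⟶ X), f = g := fun X f g => by
      ext
      have hf : φ ≫ f.right = X.hom := Under.w f
      have hg : φ ≫ g.right = X.hom := Under.w g
      exact (cancel_epi φ).mp (hf.trans hg.symm)
    have hsec : ∀ (s : Cocone (K ⋙ coyoneda.obj (op (Under.mk φ)))) (j j' : J)
        (x : Under.mk φ ⟶ K.obj j) (x' : Under.mk φ ⟶ K.obj j'),
        s.ι.app j x = s.ι.app j' x' := fun s j j' x x' => by
      obtain ⟨k, a, b, -⟩ := IsFilteredOrEmpty.cocone_objs j j'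
      have h₁ := ConcreteCategory.congr_hom (s.w a) x
      have h₂ := ConcreteCategory.congr_hom (s.w b) x'
      exact (h₁.symm.trans (congrArg (s.ι.app k) (hs _ _ _))).trans h₂
    have H' : ∀ f : Under.mk φ ⟶ c.pt, ∃ j, Nonempty (Under.mk φ ⟶ K.obj j) := H J K c hc
    exact ⟨
      { desc := fun s => ↾fun f => s.ι.app (H' f).choose (H' f).choose_spec.some
        fac := fun s j => by
          ext x
          exact hsec s _ _ _ _
        uniq := fun s g hg => by
          ext f
          exact (congrArg g (hs _ _ _)).trans
            (ConcreteCategory.congr_hom (hg (H' f).choose) (H' f).choose_spec.some) }⟩⟩⟩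

theorem _root_.IsFinitelyPresented.id (A : 𝓒) : IsFinitelyPresented (𝟙 A) :=
  .of_epi _ fun J _ _ K _ _ _ =>
    ⟨(IsFiltered.nonempty (C := J)).some, ⟨Under.homMk (K.obj _).hom (Category.id_comp _)⟩⟩

theorem isZariskiOpen_id (A : 𝓒) (h : S.IsFlat (𝟙 A)) : S.IsZariskiOpen (𝟙 A) :=
  ⟨inferInstance, h, IsFinitelyPresented.id A⟩

theorem isZariskiOpenSieve_top (A : 𝓒) (h : S.IsFlat (𝟙 A)) :
    S.IsZariskiOpenSieve (⊤ : Sieve (op A)) := by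
  refine ⟨Presieve.singleton (𝟙 _), ?_, ?_⟩
  · rintro Y f ⟨⟩
    exact S.isZariskiOpen_id A h
  · rw [eq_comm, GrothendieckTopology.close_eq_top_iff_mem]
    convert S.zariskiTopology.top_mem (op A)
    rw [← Sieve.id_mem_iff_eq_top]
    exact ⟨_, 𝟙 _, _, ⟨⟩, by simp⟩

end ModuleSystem

/-- A Zariski sheaf which is an affine scheme is a scheme. -/
theorem IsRelativeScheme.of_isAffineScheme {𝓒 : Type (u + 1)} [Category.{u} 𝓒]
    (S : ModuleSystem 𝓒) (hS : ∀ A : 𝓒, S.IsFlat (𝟙 A)) {F : 𝓒ᵒᵖᵒᵖ ⥤ Type (u + 1)}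
    (hF : Presheaf.IsSheaf S.zariskiTopology F) (h : IsAffineScheme F) : IsRelativeScheme S F := by
  obtain ⟨A, ⟨e⟩⟩ := h
  have htop : ∀ (T : 𝓒ᵒᵖ) (s : F.obj (op T)),
      (Subfunctor.range e.inv).sieveOfSection s = ⊤ := fun T s => by
    rw [← Sieve.id_mem_iff_eq_top]
    exact ⟨e.hom.app _ (F.map (𝟙 T).op s), by simp⟩
  refine ⟨hF, PUnit, fun _ => A, fun _ => e.inv, fun _ => ⟨fun T => ?_, fun X x => ?_⟩,
    fun T s => ?_⟩
  · exact ((e.symm.app T).toEquiv).injective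
  · rw [htop]
    exact S.isZariskiOpenSieve_top _ (hS _)
  · simp only [htop, iSup_const]
    exact S.zariskiTopology.top_mem T

/-! ### Faithfully flat descent for semimodules -/

section Descent

variable {A : Type u} [CommSemiring A]

/-- Tensoring with `B` preserves injective linear maps. -/
def TensorPreservesInjective (A B : Type u) [CommSemiring A] [CommSemiring B] [Algebra A B] :
    Prop :=
  ∀ ⦃P Q : Type u⦄ [AddCommMonoid P] [AddCommMonoid Q] [Module A P] [Module A Q] (f : P →ₗ[A] Q),
    Function.Injective f → Function.Injective (f.lTensor B)

/-- The functors `B j ⊗ -` jointly detect bijections. -/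
def TensorDetectsBijective (A : Type u) [CommSemiring A] {J : Type} (B : J → Type u)
    [∀ j, CommSemiring (B j)] [∀ j, Algebra A (B j)] : Prop :=
  ∀ ⦃P Q : Type u⦄ [AddCommMonoid P] [AddCommMonoid Q] [Module A P] [Module A Q] (f : P →ₗ[A] Q),
    (∀ j, Function.Bijective (f.lTensor (B j))) → Function.Bijective f

/-- Finite products of semimodules are also direct sums, and tensoring respects direct sums: an
element is recovered as the sum of its components. -/
theorem TensorProduct.pi_ext {J : Type} [Finite J] {B : Type u} [AddCommMonoid B] [Module A B]
    {N : J → Type u} [∀ j, AddCommMonoid (N j)] [∀ j, Module A (N j)] {z z' : B ⊗[A] (∀ j, N j)}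
    (h : ∀ j, (LinearMap.proj j : (∀ j, N j) →ₗ[A] N j).lTensor B z =
      (LinearMap.proj j : (∀ j, N j) →ₗ[A] N j).lTensor B z') : z = z' := by
  classical
  have := Fintype.ofFinite J
  have key : ∀ z : B ⊗[A] (∀ j, N j), z = ∑ j, (LinearMap.single A N j).lTensor B
      ((LinearMap.proj j : (∀ j, N j) →ₗ[A] N j).lTensor B z) := fun z => by
    induction z with
    | zero => simp
    | add x y hx hy =>
      simp only [map_add, Finset.sum_add_distrib]
      rw [← hx, ← hy]
    | tmul b n =>
      simp only [LinearMap.lTensor_tmul, LinearMap.proj_apply, ← TensorProduct.tmul_sum]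
      congr 1
      exact (LinearMap.sum_single_apply N n).symm
  rw [key z, key z']
  simp only [h]

/-- The multiplication `B ⊗ (B ⊗ M) → B ⊗ M`. -/
noncomputable def tensorMul (A B M : Type u) [CommSemiring A] [CommSemiring B] [Algebra A B]
    [AddCommMonoid M] [Module A M] : B ⊗[A] (B ⊗[A] M) →ₗ[A] B ⊗[A] M :=
  (LinearMap.mul' A B).rTensor M ∘ₗ (TensorProduct.assoc A B B M).symm.toLinearMap

section

variable {B M N : Type u} [CommSemiring B] [Algebra A B] [AddCommMonoid M] [Module A M]
  [AddCommMonoid N] [Module A N]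

@[simp]
theorem tensorMul_tmul (b b' : B) (m : M) :
    tensorMul A B M (b ⊗ₜ (b' ⊗ₜ m)) = (b * b') ⊗ₜ m := by
  simp [tensorMul]

theorem tensorMul_lTensor_mk (z : B ⊗[A] M) :
    tensorMul A B M ((TensorProduct.mk A B M 1).lTensor B z) = z := by
  induction z with
  | zero => simp
  | add x y hx hy => simp only [map_add, hx, hy]
  | tmul b m => simp

theorem tensorMul_naturality (f : M →ₗ[A] N) (z : B ⊗[A] (B ⊗[A] M)) :
    tensorMul A B N ((f.lTensor B).lTensor B z) = f.lTensor B (tensorMul A B M z) := by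
  induction z with
  | zero => simp
  | add x y hx hy => simp only [map_add, hx, hy]
  | tmul b y =>
    induction y with
    | zero => simp
    | add x y hx hy => simp only [map_add, hx, hy, TensorProduct.tmul_add]
    | tmul b' m => simp

end

variable (A) {J : Type} (B : J → Type u) [∀ j, CommSemiring (B j)] [∀ j, Algebra A (B j)]
  (M : Type u) [AddCommMonoid M] [Module A M]

/-- The module of descent data for elements of `M` along the algebras `B j`. -/
noncomputable def descentData : Submodule A (∀ j, B j ⊗[A] M) :=
  LinearMap.eqLocus
    (LinearMap.pi fun i => LinearMap.pi fun j =>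
      (TensorProduct.mk A (B i) (B j ⊗[A] M) 1) ∘ₗ LinearMap.proj j :
      (∀ j, B j ⊗[A] M) →ₗ[A] ∀ i j, B i ⊗[A] (B j ⊗[A] M))
    (LinearMap.pi fun i => LinearMap.pi fun j =>
      ((TensorProduct.mk A (B j) M 1).lTensor (B i)) ∘ₗ LinearMap.proj i)

theorem mem_descentData {c : ∀ j, B j ⊗[A] M} : c ∈ descentData A B M ↔
    ∀ i j, (1 : B i) ⊗ₜ[A] c j = (TensorProduct.mk A (B j) M 1).lTensor (B i) (c i) := by
  rw [descentData, LinearMap.mem_eqLocus]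
  simp [funext_iff]

/-- The canonical map from `M` to the descent data. -/
noncomputable def toDescentData : M →ₗ[A] descentData A B M :=
  LinearMap.codRestrict (descentData A B M)
    (LinearMap.pi fun j => TensorProduct.mk A (B j) M 1 : M →ₗ[A] ∀ j, B j ⊗[A] M) fun m => by
    rw [mem_descentData A B M]
    intro i j
    simp

variable {A B} [Finite J]

/-- After tensoring with `B k`, projecting to the component `k` and multiplying is a left inverse.
That it is also a right inverse is checked inside the product, where flatness embeds `B k ⊗
descentData`; there it is the gluing condition for the pair `(k, j)` followed by multiplication. -/
theorem toDescentData_bijective (hB : ∀ j, TensorPreservesInjective A (B j))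
    (hc : TensorDetectsBijective A B) : Function.Bijective (toDescentData A B M) := by
  refine hc _ fun k => ?_
  let p : ∀ j, descentData A B M →ₗ[A] B j ⊗[A] M := fun j =>
    LinearMap.proj j ∘ₗ (descentData A B M).subtype
  have hp : ∀ j, p j ∘ₗ toDescentData A B M = TensorProduct.mk A (B j) M 1 := fun j => rfl
  have hp' : ∀ j z, (p j).lTensor (B k) ((toDescentData A B M).lTensor (B k) z) =
      (TensorProduct.mk A (B j) M 1).lTensor (B k) z := fun j z => by
    rw [← LinearMap.comp_apply, ← LinearMap.lTensor_comp, hp]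
  constructor
  · refine Function.LeftInverse.injective
      (g := tensorMul A (B k) M ∘ (p k).lTensor (B k)) fun z => ?_
    rw [Function.comp_apply, hp', tensorMul_lTensor_mk]
  · intro z
    refine ⟨tensorMul A (B k) M ((p k).lTensor (B k) z), ?_⟩
    refine hB k (descentData A B M).subtype Subtype.val_injective (TensorProduct.pi_ext fun j => ?_)
    have hpj : ∀ y, (LinearMap.proj j).lTensor (B k) ((descentData A B M).subtype.lTensor (B k) y) =
        (p j).lTensor (B k) y := fun y => (LinearMap.lTensor_comp_apply (B k) _ _ y).symm
    rw [hpj, hpj, hp']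
    have h : TensorProduct.mk A (B k) (B j ⊗[A] M) 1 ∘ₗ p j =
        (TensorProduct.mk A (B j) M 1).lTensor (B k) ∘ₗ p k := by
      ext c
      exact (mem_descentData A B M).mp c.2 k j
    have h' := congrArg (fun l => tensorMul A (B k) (B j ⊗[A] M) (l.lTensor (B k) z)) h
    simp only [LinearMap.lTensor_comp, LinearMap.comp_apply, tensorMul_lTensor_mk,
      tensorMul_naturality] at h'
    exact h'.symm

/-- Descent for morphisms into an algebra. -/
theorem existsUnique_ringHom_of_descent {A' R : Type u} [CommSemiring A'] [Algebra A A']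
    [CommSemiring R]
    (hB : ∀ j, TensorPreservesInjective A (B j)) (hc : TensorDetectsBijective A B)
    (x : ∀ j, R →+* B j ⊗[A] A')
    (hx : ∀ i j r, (1 : B i) ⊗ₜ[A] x j r =
      (TensorProduct.mk A (B j) A' 1).lTensor (B i) (x i r)) :
    ∃! t : R →+* A', ∀ j r, (1 : B j) ⊗ₜ[A] t r = x j r := by
  have hb := toDescentData_bijective A' hB hc
  have hinj : ∀ a a' : A', (∀ j, (1 : B j) ⊗ₜ[A] a = 1 ⊗ₜ a') → a = a' := fun a a' h =>
    hb.1 (Subtype.ext (funext h))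
  have hsurj : ∀ r, ∃ a : A', ∀ j, (1 : B j) ⊗ₜ[A] a = x j r := fun r => by
    obtain ⟨a, ha⟩ := hb.2 ⟨fun j => x j r, (mem_descentData A B A').mpr fun i j => hx i j r⟩
    exact ⟨a, fun j => congrFun (congrArg Subtype.val ha) j⟩
  choose t ht using hsurj
  -- The pointwise lifts form a ring morphism since each identity may be tested after base change to
  -- all `B j`, where the `x j` are morphisms.
  refine ⟨⟨⟨⟨t, ?_⟩, ?_⟩, ?_, ?_⟩, fun j r => ht r j, fun t' ht' => RingHom.ext fun r => hinj _ _ fun j => ?_⟩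
  · exact hinj _ _ fun j => by rw [ht, map_one]; rfl
  · refine fun r s => hinj _ _ fun j => ?_
    rw [ht, map_mul, ← ht, ← ht, Algebra.TensorProduct.tmul_mul_tmul, one_mul]
  · exact hinj _ _ fun j => by rw [ht, map_zero, TensorProduct.tmul_zero]
  · refine fun r s => hinj _ _ fun j => ?_
    rw [ht, map_add, ← ht, ← ht, TensorProduct.tmul_add]
  · exact (ht' j r).trans (ht r j).symm

end Descent

/-! ### Flatness and conservativity in terms of elements -/

section Bridge

theorem SemimoduleCat.isIso_iff_bijective {A : Type u} [CommSemiring A] {M N : SemimoduleCat.{u} A}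
    (f : M ⟶ N) : IsIso f ↔ Function.Bijective f.hom := by
  constructor
  · intro h
    exact (asIso f).toLinearEquivₛ.bijective
  · intro h
    exact (LinearEquiv.ofBijective f.hom h).toModuleIsoₛ.isIso_hom

/-- Elements are morphisms from the free module `A`, so a monomorphism separates them. -/
theorem SemimoduleCat.mono_iff_injective {A : Type u} [CommSemiring A] {M N : SemimoduleCat.{u} A}
    (f : M ⟶ N) : Mono f ↔ Function.Injective f.hom := by
  constructor
  · intro h x y hxy
    have := (cancel_mono f).mp (show SemimoduleCat.ofHom (LinearMap.toSpanSingleton A M x) ≫ f =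
      SemimoduleCat.ofHom (LinearMap.toSpanSingleton A M y) ≫ f by
        ext
        simpa using hxy)
    have := ConcreteCategory.congr_hom this (1 : A)
    simpa using this
  · intro h
    refine ⟨fun a b hab => ?_⟩
    ext z
    exact h (ConcreteCategory.congr_hom hab z)

theorem modulesN_tensorPreservesInjective {A B : CommSemiRingCat.{u}} (φ : A ⟶ B)
    (h : modulesN.IsFlat φ) :
    letI := φ.hom.toAlgebra
    TensorPreservesInjective A B := by
  let := φ.hom.toAlgebra
  intro P Q _ _ _ _ f hf
  have : PreservesFiniteLimits (semimoduleExtend φ.hom) := h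
  have hm : Mono (SemimoduleCat.ofHom f) := (SemimoduleCat.mono_iff_injective _).mpr hf
  exact (SemimoduleCat.mono_iff_injective ((semimoduleExtend φ.hom).map (SemimoduleCat.ofHom f))).mp
    inferInstance

theorem modulesN_tensorDetectsBijective {A : CommSemiRingCat.{u}} {J : Type}
    {B : J → CommSemiRingCat.{u}} (φ : ∀ j, A ⟶ B j) (h : modulesN.JointlyConservative φ) :
    letI := fun j => (φ j).hom.toAlgebra
    TensorDetectsBijective A (fun j => B j) := by
  let := fun j => (φ j).hom.toAlgebra
  intro P Q _ _ _ _ f hf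
  exact (SemimoduleCat.isIso_iff_bijective _).mp
    (h (SemimoduleCat.ofHom f) fun j => (SemimoduleCat.isIso_iff_bijective _).mpr (hf j))

theorem modulesZ_tensorPreservesInjective {A B : CommRingCat.{u}} (φ : A ⟶ B)
    (h : modulesZ.IsFlat φ) :
    letI := φ.hom.toAlgebra
    TensorPreservesInjective A B := by
  let := φ.hom.toAlgebra
  intro P Q _ _ _ _ f hf
  -- Over a ring, the action of `-1` provides negatives, so every semimodule is a module and the
  -- ring case fits the semiring formulation.
  let := Module.addCommMonoidToAddCommGroup A (M := P)
  let := Module.addCommMonoidToAddCommGroup A (M := Q)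
  have : PreservesFiniteLimits (ModuleCat.extendScalars.{u, u, u} φ.hom) := h
  have hm : Mono (ModuleCat.ofHom f) := (ModuleCat.mono_iff_injective _).mpr hf
  exact (ModuleCat.mono_iff_injective
    ((ModuleCat.extendScalars.{u, u, u} φ.hom).map (ModuleCat.ofHom f))).mp inferInstance

theorem modulesZ_tensorDetectsBijective {A : CommRingCat.{u}} {J : Type}
    {B : J → CommRingCat.{u}} (φ : ∀ j, A ⟶ B j) (h : modulesZ.JointlyConservative φ) :
    letI := fun j => (φ j).hom.toAlgebra
    TensorDetectsBijective A (fun j => B j) := by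
  let := fun j => (φ j).hom.toAlgebra
  intro P Q _ _ _ _ f hf
  let := Module.addCommMonoidToAddCommGroup A (M := P)
  let := Module.addCommMonoidToAddCommGroup A (M := Q)
  exact (ConcreteCategory.isIso_iff_bijective (ModuleCat.ofHom f)).mp
    (h (M := ModuleCat.of A P) (N := ModuleCat.of A Q) (ModuleCat.ofHom f) fun j =>
      (ConcreteCategory.isIso_iff_bijective
        ((ModuleCat.extendScalars.{u, u, u} (φ j).hom).map (ModuleCat.ofHom f))).mpr (hf j))

end Bridge

/-! ### Affine schemes over ℕ and ℤ are sheaves -/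

section Subcanonical

theorem CommSemiRingCat.isPushout_tensorProduct (A B A' : Type u) [CommSemiring A] [CommSemiring B]
    [CommSemiring A'] [Algebra A B] [Algebra A A'] :
    IsPushout (CommSemiRingCat.ofHom (algebraMap A A')) (CommSemiRingCat.ofHom (algebraMap A B))
      (CommSemiRingCat.ofHom
        (Algebra.TensorProduct.includeRight (R := A) (A := B) (B := A')).toRingHom)
      (CommSemiRingCat.ofHom
        (Algebra.TensorProduct.includeLeftRingHom (R := A) (A := B) (B := A'))) := by
  refine ⟨⟨?_⟩, ⟨PushoutCocone.IsColimit.mk _ (fun s => ?_) (fun s => ?_) (fun s => ?_)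
    fun s m h₁ h₂ => ?_⟩⟩
  · ext a
    simp
  · letI : Algebra A s.pt := (s.inl.hom.comp (algebraMap A A')).toAlgebra
    exact CommSemiRingCat.ofHom (Algebra.TensorProduct.lift (R := A) (S := A)
      (A := B) (B := A') (C := s.pt)
      { s.inr.hom with
        commutes' := fun a => (ConcreteCategory.congr_hom s.condition a).symm }
      { s.inl.hom with commutes' := fun a => rfl }
      fun _ _ => Commute.all _ _).toRingHom
  · ext a
    simp
  · ext a
    simp
  · ext z
    · have := ConcreteCategory.congr_hom h₂ z
      simpa using this
    · have := ConcreteCategory.congr_hom h₁ z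
      simpa using this

/-- The affine schemes over `ℕ` are Zariski sheaves. -/
theorem isSheaf_specSheaf_zarN (R : CommSemiRingCat.{u}) :
    Presieve.IsSheaf zarN.{u} (specSheaf R) := by
  refine modulesN.isSheaf_zariskiTopology_of_pushouts _ fun {A A'} h m B φ hφ hc => ?_
  let _ := h.hom.toAlgebra
  let _ := fun j => (φ j).hom.toAlgebra
  refine ⟨fun j => .of (B j ⊗[A] A'), _, _,
    fun j => CommSemiRingCat.isPushout_tensorProduct A (B j) A', fun x hx => ?_⟩
  obtain ⟨t, ht, htu⟩ := existsUnique_ringHom_of_descent (R := R) (A' := A') (B := fun j => B j)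
    (fun j => modulesN_tensorPreservesInjective (φ j) (hφ j).flat)
    (modulesN_tensorDetectsBijective φ hc) (fun j => (x j).down.unop.hom) fun i j r => by
      -- The overlap condition is needed only on `B i ⊗ (B j ⊗ A')`, with its two maps from `B i ⊗
      -- A'` and `B j ⊗ A'`.
      have := hx i j (.of (B i ⊗[A] (B j ⊗[A] A')))
        (CommSemiRingCat.ofHom (Algebra.TensorProduct.map (AlgHom.id A (B i))
          (Algebra.TensorProduct.includeRight (R := A) (A := B j) (B := A'))).toRingHom)
        (CommSemiRingCat.ofHom
          (Algebra.TensorProduct.includeRight (R := A) (A := B i) (B := B j ⊗[A] A')).toRingHom)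
        (by ext a; simp)
      exact (ConcreteCategory.congr_hom (congrArg (fun z => z.down.unop) this) r).symm
  refine ⟨⟨(CommSemiRingCat.ofHom t).op⟩, fun j => ?_, fun t' ht' => ?_⟩
  · refine ULift.ext _ _ (Quiver.Hom.unop_inj ?_)
    ext r
    exact ht j r
  · refine ULift.ext _ _ (Quiver.Hom.unop_inj (CommSemiRingCat.hom_ext ?_))
    exact htu _ fun j r =>
      ConcreteCategory.congr_hom (congrArg (fun z => z.down.unop) (ht' j)) r

/-- The affine schemes over `ℤ` are Zariski sheaves. -/
theorem isSheaf_specSheaf_zarZ (R : CommRingCat.{u}) :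
    Presieve.IsSheaf zarZ.{u} (specSheaf R) := by
  refine modulesZ.isSheaf_zariskiTopology_of_pushouts _ fun {A A'} h m B φ hφ hc => ?_
  let _ := h.hom.toAlgebra
  let _ := fun j => (φ j).hom.toAlgebra
  refine ⟨fun j => .of (B j ⊗[A] A'), _, _,
    fun j => (CommRingCat.isPushout_tensorProduct A (B j) A').flip, fun x hx => ?_⟩
  obtain ⟨t, ht, htu⟩ := existsUnique_ringHom_of_descent (R := R) (A' := A') (B := fun j => B j)
    (fun j => modulesZ_tensorPreservesInjective (φ j) (hφ j).flat)
    (modulesZ_tensorDetectsBijective φ hc) (fun j => (x j).down.unop.hom) fun i j r => by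
      have := hx i j (.of (B i ⊗[A] (B j ⊗[A] A')))
        (CommRingCat.ofHom (Algebra.TensorProduct.map (AlgHom.id A (B i))
          (Algebra.TensorProduct.includeRight (R := A) (A := B j) (B := A'))).toRingHom)
        (CommRingCat.ofHom
          (Algebra.TensorProduct.includeRight (R := A) (A := B i) (B := B j ⊗[A] A')).toRingHom)
        (by ext a; simp)
      exact (ConcreteCategory.congr_hom (congrArg (fun z => z.down.unop) this) r).symm
  refine ⟨⟨(CommRingCat.ofHom t).op⟩, fun j => ?_, fun t' ht' => ?_⟩
  · refine ULift.ext _ _ (Quiver.Hom.unop_inj ?_)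
    ext r
    exact ht j r
  · refine ULift.ext _ _ (Quiver.Hom.unop_inj (CommRingCat.hom_ext ?_))
    exact htu _ fun j r =>
      ConcreteCategory.congr_hom (congrArg (fun z => z.down.unop) (ht' j)) r

end Subcanonical

/-! ### Flat morphisms of monoids and triviality of the topology over 𝔽₁ -/

section ActFlat

variable {A B : Type u} [CommMonoid A] [CommMonoid B]

/-- The morphism from the free `A`-set of rank one given by an element. -/
def Action.ofElement (X : Action (Type u) A) (x : X.V) : Action.leftRegular A ⟶ X where
  hom := ↾fun a => X.ρ a x
  comm a := by
    ext b
    exact ConcreteCategory.congr_hom (map_mul X.ρ a b) x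

theorem Action.ofElement_one (X : Action (Type u) A) (x : X.V) :
    (Action.ofElement X x).hom (1 : A) = x :=
  ConcreteCategory.congr_hom (map_one X.ρ) x

theorem Action.isIso_iff_bijective {X Y : Action (Type u) A} (f : X ⟶ Y) :
    IsIso f ↔ Function.Bijective f.hom := by
  rw [← CategoryTheory.isIso_iff_bijective]
  exact ⟨fun _ => (Action.forget (Type u) A).map_isIso f, fun _ => Action.isIso_of_hom_isIso f⟩

theorem Action.injective_of_mono {X Y : Action (Type u) A} (f : X ⟶ Y) [Mono f] :
    Function.Injective f.hom :=
  (mono_iff_injective _).mp ((Action.forget (Type u) A).map_mono f)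

theorem Action.mono_of_injective {X Y : Action (Type u) A} (f : X ⟶ Y)
    (h : Function.Injective f.hom) : Mono f where
  right_cancellation a b hab := by
    ext z
    exact h (ConcreteCategory.congr_hom (congrArg Action.Hom.hom hab) z)

theorem actTensor_mk_eq (φ : A →* B) (X : Action (Type u) A) (a : A) (b : B) (x : X.V) :
    (Quot.mk _ (b * φ a, x) : ActTensor φ X) = Quot.mk _ (b, X.ρ a x) :=
  Quot.sound ⟨a, b, x, rfl, rfl⟩

/-- `B ⊗_A A = B`. -/
def actTensorSelf (φ : A →* B) : ActTensor φ (Action.leftRegular A) ≃ B where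
  toFun := Quot.lift (fun p => p.1 * φ p.2) (by
    rintro _ _ ⟨a, b, x, rfl, rfl⟩
    exact (mul_assoc _ _ _).trans (congrArg (b * ·) (map_mul φ a x).symm))
  invFun b := Quot.mk _ (b, (1 : A))
  left_inv := by
    rintro ⟨b, a⟩
    exact (actTensor_mk_eq φ (Action.leftRegular A) a b (1 : A)).trans
      (congrArg (fun z : A => (Quot.mk _ (b, z) : ActTensor φ (Action.leftRegular A)))
        (@mul_one A _ a))
  right_inv b := by
    change b * φ 1 = b
    simp

theorem actTensorSelf_mk (φ : A →* B) (b : B) (a : A) :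
    actTensorSelf φ (Quot.mk _ (b, a)) = b * φ a := rfl

/-- Flatness applied to the product `A × A`: the pair `b` defines a cone with vertex `B`, and its
lift sends `1` to the class of some `(c, a)` in `B ⊗ (A × A)`, whose projections are the products `c
* φ (a i)`. -/
theorem actExtend_common_multiple (φ : A →* B) [PreservesFiniteLimits (actExtend φ)] (b : Bool → B) :
    ∃ (c : B) (a : Bool → A), ∀ i, b i = c * φ (a i) := by
  let F : Bool → Type u := fun _ => A
  have hl := isLimitOfPreserves (actExtend φ) (Action.ofMulActionLimitCone A F).isLimit
  let s : Cone ((Discrete.functor fun i => Action.ofMulAction A (F i)) ⋙ actExtend φ) :=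
    { pt := Action.leftRegular B
      π := Discrete.natTrans fun i => Action.ofElement _ ((actTensorSelf φ).symm (b i.as)) }
  have hf : ∀ i, actTensorSelf φ ((((actExtend φ).mapCone
      (Action.ofMulActionLimitCone A F).cone).π.app ⟨i⟩).hom ((hl.lift s).hom (1 : B))) = b i :=
    fun i => by
      have h := ConcreteCategory.congr_hom (congrArg Action.Hom.hom (hl.fac s ⟨i⟩)) (1 : B)
      refine (congrArg (actTensorSelf φ) (h.trans (Action.ofElement_one _ _))).trans ?_
      exact (actTensorSelf φ).apply_symm_apply (b i)
  obtain ⟨⟨c, a⟩, hz⟩ : ∃ p : B × (Bool → A), Quot.mk _ p = (hl.lift s).hom (1 : B) :=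
    Quot.exists_rep _
  refine ⟨c, a, fun i => ?_⟩
  rw [← hf i, ← hz]
  rfl

/-- The elements on which multiplication by `a` and `a'` agree. -/
abbrev MulEqLocus (a a' : A) : Type u := {e : A // e * a = e * a'}

instance (a a' : A) : MulAction A (MulEqLocus a a') where
  smul c x := ⟨c * x.1, by rw [mul_assoc, x.2, mul_assoc]⟩
  one_smul x := Subtype.ext (one_mul x.1)
  mul_smul c d x := Subtype.ext (mul_assoc c d x.1)

/-- Flatness applied to the equalizer of multiplication by `a` and by `a'`: since `φ a = φ a'`, the
element `1 ⊗ 1` of `B ⊗ A` comes from some `c ⊗ e` with `e` in the equalizer. -/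
theorem actExtend_exists_eq (φ : A →* B) [PreservesFiniteLimits (actExtend φ)] {a a' : A}
    (h : φ a = φ a') : ∃ (c : B) (e : A), e * a = e * a' ∧ c * φ e = 1 := by
  let f : Action.leftRegular A ⟶ Action.leftRegular A := Action.ofElement _ a
  let g : Action.leftRegular A ⟶ Action.leftRegular A := Action.ofElement _ a'
  let i : Action.ofMulAction A (MulEqLocus a a') ⟶ Action.leftRegular A :=
    { hom := ↾Subtype.val
      comm := fun _ => rfl }
  have w : i ≫ f = i ≫ g := by
    ext x
    exact x.2
  have hE : IsLimit (Fork.ofι i w) := Fork.IsLimit.mk' _ fun s =>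
    ⟨{ hom := ↾fun z => ⟨s.ι.hom z,
        ConcreteCategory.congr_hom (congrArg Action.Hom.hom s.condition) z⟩
       comm := fun c => by
        ext z
        exact Subtype.ext (ConcreteCategory.congr_hom (s.ι.comm c) z :) }, rfl, fun {m} hm => by
          ext z
          exact Subtype.ext (ConcreteCategory.congr_hom (congrArg Action.Hom.hom hm) z :)⟩
  have hl := isLimitForkMapOfIsLimit (actExtend φ) w hE
  let k : Action.leftRegular B ⟶ (actExtend φ).obj (Action.leftRegular A) :=
    Action.ofElement _ (Quot.mk _ ((1 : B), (1 : A)))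
  have hk : k ≫ (actExtend φ).map f = k ≫ (actExtend φ).map g := by
    ext b
    apply (actTensorSelf φ).injective
    change ((show B from b) * (1 : B)) * φ ((1 : A) * a) = (show B from b) * (1 : B) * φ ((1 : A) * a')
    simp [h]
  obtain ⟨l, hl'⟩ := Fork.IsLimit.lift' hl k hk
  obtain ⟨⟨c, e⟩, hz⟩ : ∃ p : B × MulEqLocus a a', Quot.mk _ p = l.hom (1 : B) := Quot.exists_rep _
  refine ⟨c, e.1, e.2, ?_⟩
  have h₁ := ConcreteCategory.congr_hom (congrArg Action.Hom.hom hl') (1 : B)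
  have h₂ := congrArg (actTensorSelf φ) (h₁.trans (Action.ofElement_one _ _))
  have h₃ : actTensorSelf φ (((actExtend φ).map i).hom (Quot.mk _ (c, e))) = 1 := by
    refine (congrArg (fun z => actTensorSelf φ (((actExtend φ).map i).hom z)) hz).trans
      (h₂.trans ?_)
    rw [actTensorSelf_mk]
    simp
  exact h₃

/-- A flat local morphism of commutative monoids is bijective. -/
theorem bijective_of_flat_of_local (φ : A →* B) [PreservesFiniteLimits (actExtend φ)]
    (hφ : ∀ a, IsUnit (φ a) → IsUnit a) : Function.Bijective φ := by
  constructor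
  · intro a a' h
    obtain ⟨c, e, he, hc⟩ := actExtend_exists_eq φ h
    have := hφ e (IsUnit.of_mul_eq_one_right c hc)
    exact this.mul_left_cancel he
  · intro b
    -- Pairing `b` with `1` makes the second multiplier a unit by locality, so that `c` is in the
    -- image of `φ`.
    obtain ⟨c, a, h⟩ := actExtend_common_multiple φ fun i => bif i then 1 else b
    have h₁ : (1 : B) = c * φ (a true) := h true
    have h₂ : b = c * φ (a false) := h false
    obtain ⟨u, hu⟩ := hφ _ (IsUnit.of_mul_eq_one_right c h₁.symm)
    refine ⟨a false * ↑u⁻¹, ?_⟩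
    have : φ (u : A) * φ (↑u⁻¹ : A) = 1 := by rw [← map_mul, Units.mul_inv, map_one]
    rw [h₂, map_mul]
    calc φ (a false) * φ ↑u⁻¹ = (c * φ (a true)) * (φ (a false) * φ ↑u⁻¹) := by
          rw [← h₁, one_mul]
      _ = (c * φ (a false)) * (φ u * φ ↑u⁻¹) := by rw [hu]; ac_rfl
      _ = c * φ (a false) := by rw [this, mul_one]

instance (A : Type u) [CommMonoid A] : MulAction A {a : A // ¬ IsUnit a} where
  smul a x := ⟨a * x.1, fun h => x.2 (isUnit_of_mul_isUnit_right h)⟩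
  one_smul x := Subtype.ext (one_mul x.1)
  mul_smul a b x := Subtype.ext (mul_assoc a b x.1)

/-- The inclusion of the nonunits. -/
def nonunitsIncl (A : Type u) [CommMonoid A] :
    Action.ofMulAction A {a : A // ¬ IsUnit a} ⟶ Action.leftRegular A where
  hom := ↾Subtype.val
  comm := fun _ => rfl

/-- Flatness preserves the monomorphism, and once `φ a` is invertible, `b ⊗ 1 = b (φ a)⁻¹ ⊗ a` lies
in the image of the nonunits. -/
theorem actExtend_nonunitsIncl_bijective (φ : A →* B) [PreservesFiniteLimits (actExtend φ)] {a : A}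
    (ha : ¬ IsUnit a) (hφ : IsUnit (φ a)) :
    Function.Bijective ((actExtend φ).map (nonunitsIncl A)).hom := by
  have : Mono (nonunitsIncl A) := Action.mono_of_injective _ Subtype.val_injective
  refine ⟨Action.injective_of_mono _, fun z => ?_⟩
  obtain ⟨u, hu⟩ := hφ
  refine ⟨Quot.mk _ (actTensorSelf φ z * ↑u⁻¹, ⟨a, ha⟩), (actTensorSelf φ).injective ?_⟩
  change actTensorSelf φ z * ↑u⁻¹ * φ a = actTensorSelf φ z
  rw [← hu, Units.inv_mul_cancel_right]

/-- Every Zariski covering of a commutative monoid contains an isomorphism. -/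
theorem zarF_eq_bot : zarF.{u} = ⊥ := by
  refine modulesF.zariskiTopology_eq_bot fun {A} m B φ hφ hc => ?_
  have hflat : ∀ j, PreservesFiniteLimits (actExtend (φ j).hom) := fun j => (hφ j).flat
  by_contra! hiso
  -- A member of the covering that is not an isomorphism cannot be local, hence inverts a nonunit.
  have hloc : ∀ j, ∃ a : A, IsUnit ((φ j).hom a) ∧ ¬ IsUnit a := fun j => by
    by_contra! h
    have hb := bijective_of_flat_of_local (φ j).hom h
    exact hiso j (MulEquiv.ofBijective (φ j).hom hb).toCommMonCatIso.isIso_hom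
  -- Conservativity would place `1` among the nonunits. The argument includes the empty family,
  -- which therefore never covers over 𝔽₁.
  have : IsIso (nonunitsIncl A) := hc _ fun j => by
    obtain ⟨a, h₁, h₂⟩ := hloc j
    exact (Action.isIso_iff_bijective _).mpr (actExtend_nonunitsIncl_bijective (φ j).hom h₂ h₁)
  obtain ⟨x, hx⟩ := ((Action.isIso_iff_bijective _).mp this).2 (1 : A)
  have hx' : x.1 = 1 := hx
  exact x.2 (hx' ▸ isUnit_one)

end ActFlat

/-! ### Functors of solutions of polynomial equations -/

section Representability

/-- The solutions in `A` of a system of polynomial equations with natural coefficients. -/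
abbrev PolySolutions {I : Type} (r : MvPolynomial I ℕ → MvPolynomial I ℕ → Prop) (A : Type u)
    [CommSemiring A] : Type u :=
  {x : I → A // ∀ ⦃p q⦄, r p q → MvPolynomial.aeval x p = MvPolynomial.aeval x q}

variable {I : Type} (r : MvPolynomial I ℕ → MvPolynomial I ℕ → Prop)

/-- The universal semiring with a solution of a system of polynomial equations. -/
noncomputable def ringQuotHomEquiv (A : Type u) [CommSemiring A] :
    (RingQuot r →+* A) ≃ PolySolutions r A where
  toFun f := ⟨fun i => f (RingQuot.mkRingHom r (MvPolynomial.X i)), fun p q h => by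
    have key : ∀ p, MvPolynomial.aeval (fun i => f (RingQuot.mkRingHom r (MvPolynomial.X i))) p =
        f (RingQuot.mkRingHom r p) := fun p => by
      induction p using MvPolynomial.induction_on with
      | C a => simp
      | add p q hp hq => simp only [map_add, hp, hq]
      | mul_X p i hp => simp only [map_mul, hp, MvPolynomial.aeval_X]
    rw [key, key, RingQuot.mkRingHom_rel h]⟩
  invFun x := RingQuot.lift ⟨(MvPolynomial.aeval x.1 : MvPolynomial I ℕ →ₐ[ℕ] A).toRingHom, x.2⟩
  left_inv f := by
    apply RingQuot.ringQuot_ext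
    apply MvPolynomial.ringHom_ext
    · intro n
      simp
    · intro i
      simp
  right_inv x := by
    apply Subtype.ext
    funext i
    simp

/-- The commutative ring associated with a commutative semiring. -/
abbrev IntTensor (R : Type*) [CommSemiring R] := ℤ ⊗[ℕ] R

noncomputable instance (R : Type*) [CommSemiring R] : CommRing (IntTensor R) :=
  Algebra.TensorProduct.instCommRing

/-- The universal property of the ring associated with a semiring. -/
noncomputable def intTensorHomEquiv (R A : Type*) [CommSemiring R] [CommRing A] :
    (IntTensor R →+* A) ≃ (R →+* A) where
  toFun f := f.comp (Algebra.TensorProduct.includeRight (R := ℕ) (A := ℤ) (B := R)).toRingHom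
  invFun g := (Algebra.TensorProduct.lift (Int.castRingHom A).toNatAlgHom g.toNatAlgHom
    fun _ _ => Commute.all _ _).toRingHom
  left_inv f := by
    apply (RingHom.equivNatAlgHom _ _).injective
    apply Algebra.TensorProduct.ext
    · apply AlgHom.coe_ringHom_injective
      exact RingHom.ext_int _ _
    · ext x
      refine (Algebra.TensorProduct.lift_tmul _ _ (fun _ _ => Commute.all _ _) _ _).trans ?_
      simp
      rfl
  right_inv g := by
    ext x
    simp

/-- Morphisms from a lifted semiring. -/
def uliftRingHomEquiv (R : Type v) (A : Type w) [NonAssocSemiring R] [NonAssocSemiring A] :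
    (ULift.{u} R →+* A) ≃ (R →+* A) where
  toFun f := f.comp ULift.ringEquiv.symm.toRingHom
  invFun g := g.comp ULift.ringEquiv.toRingHom

theorem IsAffineScheme.of_homEquiv {𝓒 : Type (u + 1)} [Category.{u} 𝓒] (F : 𝓒 ⥤ GrpCat.{u}) (R : 𝓒)
    (e : ∀ A, F.obj A ≃ (R ⟶ A))
    (he : ∀ {A B} (φ : A ⟶ B) (x : F.obj A), e B (F.map φ x) = e A x ≫ φ) :
    IsAffineScheme (groupPresheaf F ⋙ forget GrpCat.{u + 1}) :=
  ⟨R, ⟨NatIso.ofComponents (fun A => Equiv.toIso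
    (Equiv.ulift.trans ((e A.unop.unop).trans
      ((Quiver.Hom.opEquiv (X := R) (Y := A.unop.unop)).trans Equiv.ulift.symm))))
    fun {A B} φ => by
      ext x
      exact congrArg (fun z => ULift.up (Quiver.Hom.op z)) (he φ.unop.unop x.down)⟩⟩

theorem IsAffineScheme.of_polySolutionsN (F : CommSemiRingCat.{u} ⥤ GrpCat.{u})
    (e : ∀ A : CommSemiRingCat.{u}, F.obj A ≃ PolySolutions r A)
    (he : ∀ {A B} (φ : A ⟶ B) (x : F.obj A) i, (e B (F.map φ x)).1 i = φ ((e A x).1 i)) :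
    IsAffineScheme (groupPresheaf F ⋙ forget GrpCat.{u + 1}) := by
  let E : ∀ A : CommSemiRingCat.{u}, (CommSemiRingCat.of (ULift.{u} (RingQuot r)) ⟶ A) ≃
      PolySolutions r A := fun A =>
    (ConcreteCategory.homEquiv (C := CommSemiRingCat.{u})).trans
      ((uliftRingHomEquiv _ A).trans (ringQuotHomEquiv r A))
  refine of_homEquiv F (.of (ULift.{u} (RingQuot r))) (fun A => (e A).trans (E A).symm) ?_
  intro A B φ x
  apply (E B).injective
  refine ((E B).apply_symm_apply _).trans ?_
  apply Subtype.ext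
  funext i
  rw [he]
  have : (e A x).1 i = (E A ((E A).symm (e A x))).1 i := by rw [Equiv.apply_symm_apply]
  rw [this]
  rfl

/-- The representing ring is `ℤ ⊗ -` of the semiring representing the same equations, since a
semiring morphism to a ring extends uniquely to it. -/
theorem IsAffineScheme.of_polySolutionsZ (F : CommRingCat.{u} ⥤ GrpCat.{u})
    (e : ∀ A : CommRingCat.{u}, F.obj A ≃ PolySolutions r A)
    (he : ∀ {A B} (φ : A ⟶ B) (x : F.obj A) i, (e B (F.map φ x)).1 i = φ ((e A x).1 i)) :
    IsAffineScheme (groupPresheaf F ⋙ forget GrpCat.{u + 1}) := by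
  let E : ∀ A : CommRingCat.{u}, (CommRingCat.of (ULift.{u} (IntTensor (RingQuot r))) ⟶ A) ≃
      PolySolutions r A := fun A =>
    (ConcreteCategory.homEquiv (C := CommRingCat.{u})).trans
      ((uliftRingHomEquiv _ A).trans
        ((intTensorHomEquiv _ A).trans (ringQuotHomEquiv r A)))
  refine of_homEquiv F (.of (ULift.{u} (IntTensor (RingQuot r)))) (fun A => (e A).trans (E A).symm) ?_
  intro A B φ x
  apply (E B).injective
  refine ((E B).apply_symm_apply _).trans ?_
  apply Subtype.ext
  funext i
  rw [he]
  have : (e A x).1 i = (E A ((E A).symm (e A x))).1 i := by rw [Equiv.apply_symm_apply]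
  rw [this]
  rfl

theorem IsAffineScheme.isSheaf_zarN {F : CommSemiRingCat.{u}ᵒᵖᵒᵖ ⥤ Type (u + 1)}
    (h : IsAffineScheme F) : Presheaf.IsSheaf zarN.{u} F := by
  obtain ⟨R, ⟨e⟩⟩ := h
  rw [isSheaf_iff_isSheaf_of_type]
  exact Presieve.isSheaf_iso _ e.symm (isSheaf_specSheaf_zarN R)

theorem IsAffineScheme.isSheaf_zarZ {F : CommRingCat.{u}ᵒᵖᵒᵖ ⥤ Type (u + 1)}
    (h : IsAffineScheme F) : Presheaf.IsSheaf zarZ.{u} F := by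
  obtain ⟨R, ⟨e⟩⟩ := h
  rw [isSheaf_iff_isSheaf_of_type]
  exact Presieve.isSheaf_iso _ e.symm (isSheaf_specSheaf_zarZ R)

theorem isSheaf_group_of_forget {𝓒 : Type (u + 1)} [Category.{u} 𝓒] (J : GrothendieckTopology 𝓒ᵒᵖ)
    (F : 𝓒ᵒᵖᵒᵖ ⥤ GrpCat.{u + 1}) (h : Presheaf.IsSheaf J (F ⋙ forget GrpCat.{u + 1})) :
    Presheaf.IsSheaf J F :=
  (Presheaf.isSheaf_iff_isSheaf_forget J F (forget GrpCat.{u + 1})).mpr h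

end Representability

/-! ### `GL_n` over ℕ and ℤ is affine -/

section GeneralLinear

/-- The equations of pairs of mutually inverse matrices. -/
inductive GLRel (n : ℕ) : MvPolynomial (Fin n × Fin n ⊕ Fin n × Fin n) ℕ →
    MvPolynomial (Fin n × Fin n ⊕ Fin n × Fin n) ℕ → Prop
  | mul_inv (i j : Fin n) : GLRel n
      (∑ k, MvPolynomial.X (.inl (i, k)) * MvPolynomial.X (.inr (k, j))) (if i = j then 1 else 0)
  | inv_mul (i j : Fin n) : GLRel n
      (∑ k, MvPolynomial.X (.inr (i, k)) * MvPolynomial.X (.inl (k, j))) (if i = j then 1 else 0)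

variable (n : ℕ) (A : Type u) [CommSemiring A]

/-- Automorphisms of free modules as invertible matrices. -/
def linAutEquiv : LinAut n A ≃* (Matrix (Fin n) (Fin n) A)ˣ :=
  Units.mapEquiv (LinearMap.toMatrixAlgEquiv' (R := A) (n := Fin n)).toMulEquiv

variable {A} in
theorem linAutEquiv_map {B : Type u} [CommSemiring B] (φ : A →+* B) (g : LinAut n A) :
    linAutEquiv n B (LinAut.map n φ g) = Units.map φ.mapMatrix.toMonoidHom (linAutEquiv n A g) := by
  apply Units.ext
  simp [linAutEquiv, LinAut.map]

/-- Invertible matrices as solutions of polynomial equations. -/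
def matrixUnitsEquiv : (Matrix (Fin n) (Fin n) A)ˣ ≃ PolySolutions (GLRel n) A where
  toFun g := ⟨Sum.elim (fun p => g.1 p.1 p.2) (fun p => g.2 p.1 p.2), by
    rintro _ _ (⟨i, j⟩ | ⟨i, j⟩)
    · have := congrFun (congrFun g.mul_inv i) j
      rw [Matrix.mul_apply, Matrix.one_apply] at this
      rw [apply_ite (MvPolynomial.aeval _)]
      simpa using this
    · have := congrFun (congrFun g.inv_mul i) j
      rw [Matrix.mul_apply, Matrix.one_apply] at this
      rw [apply_ite (MvPolynomial.aeval _)]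
      simpa using this⟩
  invFun x :=
    { val := Matrix.of fun i j => x.1 (.inl (i, j))
      inv := Matrix.of fun i j => x.1 (.inr (i, j))
      val_inv := by
        ext i j
        have := x.2 (.mul_inv i j)
        rw [apply_ite (MvPolynomial.aeval _)] at this
        rw [Matrix.mul_apply, Matrix.one_apply]
        simpa using this
      inv_val := by
        ext i j
        have := x.2 (.inv_mul i j)
        rw [apply_ite (MvPolynomial.aeval _)] at this
        rw [Matrix.mul_apply, Matrix.one_apply]
        simpa using this }
  left_inv g := rfl
  right_inv x := by
    apply Subtype.ext
    funext i
    rcases i with i | i <;> rfl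

theorem matrixUnitsEquiv_map {B : Type u} [CommSemiring B] (φ : A →+* B)
    (g : (Matrix (Fin n) (Fin n) A)ˣ) (i) :
    (matrixUnitsEquiv n B (Units.map φ.mapMatrix.toMonoidHom g)).1 i =
      φ ((matrixUnitsEquiv n A g).1 i) := by
  rcases i with i | i <;> rfl

theorem isAffineScheme_glN :
    IsAffineScheme (groupPresheaf (glN.{u} n) ⋙ forget GrpCat.{u + 1}) :=
  .of_polySolutionsN (GLRel n) (glN.{u} n)
    (fun A => (linAutEquiv n A).toEquiv.trans (matrixUnitsEquiv n A)) fun φ x i => by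
      refine Eq.trans ?_ (matrixUnitsEquiv_map n _ φ.hom (linAutEquiv n _ x) i)
      exact congrArg (fun g => (matrixUnitsEquiv n _ g).1 i) (linAutEquiv_map n φ.hom x)

theorem isAffineScheme_glZ :
    IsAffineScheme (groupPresheaf (glZ.{u} n) ⋙ forget GrpCat.{u + 1}) :=
  .of_polySolutionsZ (GLRel n) (glZ.{u} n)
    (fun A => (linAutEquiv n A).toEquiv.trans (matrixUnitsEquiv n A)) fun φ x i => by
      refine Eq.trans ?_ (matrixUnitsEquiv_map n _ φ.hom (linAutEquiv n _ x) i)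
      exact congrArg (fun g => (matrixUnitsEquiv n _ g).1 i) (linAutEquiv_map n φ.hom x)

end GeneralLinear

/-! ### The group scheme 𝔾_m^n ⋊ Σ_n over ℕ -/

/-- The points with values in a commutative semiring `A` of the constant group scheme associated
with a finite group `G`: the complete families of orthogonal idempotents of `A` indexed by `G`. -/
@[ext]
structure SemiringConstGroup (G : Type) [Group G] [Fintype G] (A : Type u) [CommSemiring A] :
    Type u where
  fam : G → A
  complete : CompleteOrthogonalIdempotents fam

namespace SemiringConstGroup

variable {G : Type} [Group G] [Fintype G] {A B : Type u} [CommSemiring A] [CommSemiring B]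

theorem fam_mul_self (e : SemiringConstGroup G A) (g : G) : e.fam g * e.fam g = e.fam g :=
  (e.complete.idem g).eq

theorem fam_mul_fam (e : SemiringConstGroup G A) {g h : G} (hne : g ≠ h) :
    e.fam g * e.fam h = 0 :=
  e.complete.ortho hne

theorem sum_mul_sum (e : SemiringConstGroup G A) (x y : G → A) :
    (∑ g, e.fam g * x g) * (∑ g, e.fam g * y g) = ∑ g, e.fam g * (x g * y g) := by
  classical
  rw [Finset.sum_mul]
  refine Finset.sum_congr rfl fun g _ => ?_
  rw [Finset.mul_sum, Finset.sum_eq_single g]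
  · rw [mul_mul_mul_comm, e.fam_mul_self]
  · intro h _ hne
    rw [mul_mul_mul_comm, e.fam_mul_fam hne.symm, zero_mul]
  · simp

theorem sum_eq_one (e : SemiringConstGroup G A) : ∑ g, e.fam g = 1 := e.complete.complete

/-- The product of two families is their convolution product. -/
instance : Mul (SemiringConstGroup G A) where
  mul e f := ⟨fun g => ∑ h, e.fam h * f.fam (h⁻¹ * g), by
    refine ⟨⟨fun g => ?_, fun g g' hne => ?_⟩, ?_⟩
    · change _ * _ = _
      rw [sum_mul_sum]
      exact Finset.sum_congr rfl fun h _ => by rw [f.fam_mul_self]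
    · change _ * _ = _
      rw [sum_mul_sum]
      refine Finset.sum_eq_zero fun h _ => ?_
      rw [f.fam_mul_fam (by simpa using hne), mul_zero]
    · rw [Finset.sum_comm]
      have : ∀ h, ∑ g, e.fam h * f.fam (h⁻¹ * g) = e.fam h := fun h => by
        rw [← Finset.mul_sum, show ∑ g, f.fam (h⁻¹ * g) = 1 from
          (Equiv.sum_comp (Equiv.mulLeft h⁻¹) f.fam).trans f.sum_eq_one, mul_one]
      simp only [this, e.sum_eq_one]⟩

theorem mul_apply (e f : SemiringConstGroup G A) (g : G) :
    (e * f).fam g = ∑ h, e.fam h * f.fam (h⁻¹ * g) := rfl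

open Classical in
/-- The constant family with value `g`. -/
noncomputable def const (A : Type u) [CommSemiring A] (g : G) : SemiringConstGroup G A :=
  ⟨Pi.single g 1, by
    refine ⟨⟨fun h => ?_, fun h h' hne => ?_⟩, ?_⟩
    · rcases eq_or_ne h g with rfl | hg
      · simp [IsIdempotentElem]
      · simp [IsIdempotentElem, hg]
    · rcases eq_or_ne h g with rfl | hg
      · simp [Ne.symm hne]
      · simp [hg]
    · simp⟩

open Classical in
theorem const_apply (g h : G) : (const A g).fam h = if h = g then 1 else 0 :=
  Pi.single_apply g (1 : A) h

noncomputable instance : One (SemiringConstGroup G A) where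
  one := const A 1

open Classical in
theorem one_apply (g : G) : (1 : SemiringConstGroup G A).fam g = if g = 1 then 1 else 0 :=
  const_apply 1 g

instance : Inv (SemiringConstGroup G A) where
  inv e := ⟨fun g => e.fam g⁻¹, by
    refine ⟨⟨fun g => e.complete.idem g⁻¹, fun g g' hne => ?_⟩, ?_⟩
    · exact e.fam_mul_fam (g := g⁻¹) (h := g'⁻¹) (by simpa using hne)
    · exact (Equiv.sum_comp (Equiv.inv G) e.fam).trans e.sum_eq_one⟩

theorem inv_apply (e : SemiringConstGroup G A) (g : G) : e⁻¹.fam g = e.fam g⁻¹ := rfl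

theorem sum_mul_apply (e f : SemiringConstGroup G A) (x : G → A) :
    ∑ g, (e * f).fam g * x g = ∑ h, e.fam h * ∑ k, f.fam k * x (h * k) := by
  simp only [mul_apply, Finset.sum_mul]
  rw [Finset.sum_comm]
  refine Finset.sum_congr rfl fun h _ => ?_
  rw [Finset.mul_sum, ← Equiv.sum_comp (Equiv.mulLeft h)]
  exact Finset.sum_congr rfl fun k _ => by simp [mul_assoc]

noncomputable instance : Group (SemiringConstGroup G A) where
  mul_assoc e f k := by
    ext g : 2
    rw [mul_apply, sum_mul_apply, mul_apply]
    simp only [mul_apply, mul_inv_rev, mul_assoc]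
  one_mul e := by
    classical
    ext g : 2
    simp [mul_apply, one_apply]
  mul_one e := by
    classical
    ext g : 2
    simp [mul_apply, one_apply, inv_mul_eq_one]
  inv_mul_cancel e := by
    classical
    ext g : 2
    rw [mul_apply, ← Equiv.sum_comp (Equiv.inv G)]
    simp only [Equiv.inv_apply, inv_apply, inv_inv, one_apply]
    split_ifs with hg
    · subst hg
      simp only [mul_one, e.fam_mul_self, e.sum_eq_one]
    · refine Finset.sum_eq_zero fun h _ => e.complete.ortho ?_
      simpa using hg

/-- A family whose value at `g` is `1` is constant. -/
theorem eq_const (e : SemiringConstGroup G A) {g : G} (h : e.fam g = 1) : e = const A g := by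
  classical
  ext k : 2
  rw [const_apply]
  split_ifs with hk
  · rw [hk, h]
  · rw [← e.fam_mul_fam hk, h, mul_one]

theorem const_mul (g h : G) : const A (g * h) = const A g * const A h := by
  classical
  exact (eq_const _ (by simp [mul_apply, const_apply, inv_mul_eq_iff_eq_mul])).symm

/-- Functoriality in the semiring. -/
def map (G : Type) [Group G] [Fintype G] (φ : A →+* B) :
    SemiringConstGroup G A →* SemiringConstGroup G B where
  toFun e := ⟨fun g => φ (e.fam g), e.complete.map φ⟩
  map_one' := by
    classical
    ext g : 2
    change φ ((1 : SemiringConstGroup G A).fam g) = _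
    simp only [one_apply]
    split_ifs <;> simp
  map_mul' e f := by
    ext g : 2
    change φ (∑ h, e.fam h * f.fam (h⁻¹ * g)) = ∑ h, φ (e.fam h) * φ (f.fam (h⁻¹ * g))
    simp

theorem map_fam (φ : A →+* B) (e : SemiringConstGroup G A) (g : G) :
    (map G φ e).fam g = φ (e.fam g) := rfl

theorem map_const (φ : A →+* B) (g : G) : map G φ (const A g) = const B g :=
  eq_const _ (by simp [map_fam, const_apply])

/-- The action of the constant group scheme `Σ_n` on `𝔾_m^n` permuting the factors. -/
def permute {n : ℕ} (e : SemiringConstGroup (Equiv.Perm (Fin n)) A) (t : Fin n → Aˣ) :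
    Fin n → Aˣ :=
  fun i =>
    { val := ∑ σ, e.fam σ * (t (σ⁻¹ i) : A)
      inv := ∑ σ, e.fam σ * ((t (σ⁻¹ i))⁻¹ : Aˣ)
      val_inv := by simp [sum_mul_sum, e.sum_eq_one]
      inv_val := by simp [sum_mul_sum, e.sum_eq_one] }

theorem permute_apply {n : ℕ} (e : SemiringConstGroup (Equiv.Perm (Fin n)) A) (t : Fin n → Aˣ)
    (i : Fin n) : (e.permute t i : A) = ∑ σ, e.fam σ * (t (σ⁻¹ i) : A) := rfl

theorem permute_const {n : ℕ} (σ : Equiv.Perm (Fin n)) (t : Fin n → Aˣ) :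
    (const A σ).permute t = fun i => t (σ⁻¹ i) := by
  classical
  funext i
  apply Units.ext
  simp [permute_apply, const_apply]

noncomputable instance {n : ℕ} :
    MulDistribMulAction (SemiringConstGroup (Equiv.Perm (Fin n)) A) (Fin n → Aˣ) where
  smul := permute
  one_smul t := permute_const 1 t
  mul_smul e f t := by
    funext i
    apply Units.ext
    change (permute (e * f) t i : A) = (permute e (permute f t) i : A)
    simp only [permute_apply, sum_mul_apply, mul_inv_rev, Equiv.Perm.mul_apply]
  smul_one e := by
    funext i
    apply Units.ext
    change (permute e 1 i : A) = _
    simp [permute_apply, e.sum_eq_one]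
  smul_mul e s t := by
    funext i
    apply Units.ext
    change (permute e (s * t) i : A) = (permute e s i : A) * (permute e t i : A)
    simp [permute_apply, sum_mul_sum]

end SemiringConstGroup

section Semidirect

/-- The group of points with values in a commutative semiring `A` of `𝔾_m^n ⋊ Σ_n`. -/
noncomputable abbrev SemiringSemidirectPoints (n : ℕ) (A : Type u) [CommSemiring A] : Type u :=
  (Fin n → Aˣ) ⋊[MulDistribMulAction.toMulAut
    (SemiringConstGroup (Equiv.Perm (Fin n)) A) (Fin n → Aˣ)]
      SemiringConstGroup (Equiv.Perm (Fin n)) A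

/-- The group functor `𝔾_m^n ⋊ Σ_n` on commutative semirings. -/
noncomputable def semidirectN (n : ℕ) : CommSemiRingCat.{u} ⥤ GrpCat.{u} where
  obj A := GrpCat.of (SemiringSemidirectPoints n A)
  map {A B} φ := GrpCat.ofHom <| SemidirectProduct.map
    ((Units.map φ.hom.toMonoidHom).compLeft (Fin n))
    (SemiringConstGroup.map (Equiv.Perm (Fin n)) φ.hom) (fun e => by
      refine MonoidHom.ext fun t => funext fun i => Units.ext ?_
      change φ.hom (e.permute t i : A) =
        ((SemiringConstGroup.map (Equiv.Perm (Fin n)) φ.hom e).permute _ i : B)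
      simp only [SemiringConstGroup.permute_apply, map_sum, map_mul]
      rfl)
  map_id A := by
    apply GrpCat.hom_ext
    exact MonoidHom.ext fun x => SemidirectProduct.ext rfl rfl
  map_comp φ ψ := by
    apply GrpCat.hom_ext
    exact MonoidHom.ext fun x => SemidirectProduct.ext rfl rfl

/-- Over a commutative ring, the two descriptions of the points of `𝔾_m^n ⋊ Σ_n` agree. -/
noncomputable def semidirectPointsEquiv (n : ℕ) (A : Type u) [CommRing A] :
    SemiringSemidirectPoints n A ≃* SemidirectPoints n A where
  toFun x := ⟨x.left, ⟨x.right.fam, x.right.complete⟩⟩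
  invFun x := ⟨x.left, ⟨x.right.fam, x.right.complete⟩⟩
  left_inv _ := rfl
  right_inv _ := rfl
  map_mul' x y := by
    refine SemidirectProduct.ext ?_ rfl
    funext i
    exact Units.ext rfl

/-- The restriction of `𝔾_m^n ⋊ Σ_n` to commutative rings. -/
noncomputable def semidirectNIso (n : ℕ) :
    (forget₂ CommRingCat.{u} CommSemiRingCat.{u}).op.op ⋙ groupPresheaf (semidirectN.{u} n) ≅
      groupPresheaf (semidirectZ.{u} n) :=
  NatIso.ofComponents (fun A => MulEquiv.toGrpIso (MulEquiv.ulift.trans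
    ((semidirectPointsEquiv n A.unop.unop).trans MulEquiv.ulift.symm))) fun _ => rfl

/-- The equations of the points of `𝔾_m^n ⋊ Σ_n`. -/
inductive SemidirectRel (n : ℕ) :
    MvPolynomial ((Fin n ⊕ Fin n) ⊕ Equiv.Perm (Fin n)) ℕ →
    MvPolynomial ((Fin n ⊕ Fin n) ⊕ Equiv.Perm (Fin n)) ℕ → Prop
  | mul_inv (i : Fin n) :
      SemidirectRel n (MvPolynomial.X (.inl (.inl i)) * MvPolynomial.X (.inl (.inr i))) 1
  | idem (σ : Equiv.Perm (Fin n)) :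
      SemidirectRel n (MvPolynomial.X (.inr σ) * MvPolynomial.X (.inr σ)) (MvPolynomial.X (.inr σ))
  | ortho (σ τ : Equiv.Perm (Fin n)) (h : σ ≠ τ) :
      SemidirectRel n (MvPolynomial.X (.inr σ) * MvPolynomial.X (.inr τ)) 0
  | complete : SemidirectRel n (∑ σ, MvPolynomial.X (.inr σ)) 1

/-- The points of `𝔾_m^n ⋊ Σ_n` as solutions of polynomial equations. -/
def semidirectPolyEquiv (n : ℕ) (A : Type u) [CommSemiring A] :
    SemiringSemidirectPoints n A ≃ PolySolutions (SemidirectRel n) A where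
  toFun x := ⟨Sum.elim (Sum.elim (fun i => (x.left i : A)) (fun i => ((x.left i)⁻¹ : Aˣ)))
      x.right.fam, by
    rintro _ _ (i | σ | ⟨σ, τ, h⟩ | _)
    · simp
    · simpa using x.right.fam_mul_self σ
    · simpa using x.right.fam_mul_fam h
    · simpa using x.right.sum_eq_one⟩
  invFun x :=
    have h : ∀ i, x.1 (.inl (.inl i)) * x.1 (.inl (.inr i)) = 1 := fun i => by
      simpa using x.2 (.mul_inv i)
    ⟨fun i => ⟨x.1 (.inl (.inl i)), x.1 (.inl (.inr i)), h i, (mul_comm _ _).trans (h i)⟩,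
      ⟨fun σ => x.1 (.inr σ),
        { idem := fun σ => by simpa using! x.2 (.idem σ)
          ortho := fun σ τ h => by simpa using! x.2 (.ortho σ τ h)
          complete := by simpa using! x.2 .complete }⟩⟩
  left_inv x := by
    refine SemidirectProduct.ext ?_ rfl
    funext i
    exact Units.ext rfl
  right_inv x := by
    apply Subtype.ext
    funext i
    rcases i with (i | i) | i <;> rfl

theorem isAffineScheme_semidirectN (n : ℕ) :
    IsAffineScheme (groupPresheaf (semidirectN.{u} n) ⋙ forget GrpCat.{u + 1}) :=
  .of_polySolutionsN (SemidirectRel n) (semidirectN.{u} n) (fun A => semidirectPolyEquiv n A)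
    fun φ x i => by
      rcases i with (i | i) | i <;> rfl

theorem isAffineScheme_semidirectZ (n : ℕ) :
    IsAffineScheme (groupPresheaf (semidirectZ.{u} n) ⋙ forget GrpCat.{u + 1}) :=
  .of_polySolutionsZ (SemidirectRel n) (semidirectZ.{u} n)
    (fun A => (semidirectPointsEquiv n A).symm.toEquiv.trans (semidirectPolyEquiv n A))
    fun φ x i => by
      rcases i with (i | i) | i <;> rfl

end Semidirect

/-! ### Automorphisms of free sets as monomial matrices -/

namespace actAut

variable {n : ℕ} {A : Type u} [CommMonoid A]

/-- The coefficients of an automorphism of a free set. -/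
def coeff (e : actAut n A) (i : Fin n) : A := (e.1 ⟨i, 1⟩).2

theorem mul_apply_one (e f : actAut n A) (i : Fin n) :
    (e * f).1 ⟨i, 1⟩ = ⟨(e.1 ⟨(f.1 ⟨i, 1⟩).1, 1⟩).1, coeff f i * coeff e (f.1 ⟨i, 1⟩).1⟩ :=
  apply_mk e (f.1 ⟨i, 1⟩).1 (f.1 ⟨i, 1⟩).2

/-- The permutation of the basis defined by an automorphism of a free set. -/
def perm : actAut n A →* Equiv.Perm (Fin n) where
  toFun e :=
    { toFun := fun i => (e.1 ⟨i, 1⟩).1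
      invFun := fun i => ((e⁻¹).1 ⟨i, 1⟩).1
      left_inv := fun i => by
        have h := congrArg Sigma.fst (mul_apply_one e⁻¹ e i)
        rw [inv_mul_cancel] at h
        exact h.symm
      right_inv := fun i => by
        have h := congrArg Sigma.fst (mul_apply_one e e⁻¹ i)
        rw [mul_inv_cancel] at h
        exact h.symm }
  map_one' := rfl
  map_mul' e f := Equiv.ext fun i => (congrArg Sigma.fst (mul_apply_one e f i) :)

/-- The coefficients form a cocycle for the permutation; this gives both their invertibility and the
semidirect product law. -/
theorem coeff_mul (e f : actAut n A) (i : Fin n) :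
    coeff (e * f) i = coeff f i * coeff e (perm f i) := by
  unfold coeff
  rw [mul_apply_one]
  rfl

theorem coeff_one (i : Fin n) : coeff (1 : actAut n A) i = 1 := rfl

/-- The coefficients of an automorphism of a free set are invertible. -/
def unitCoeff (e : actAut n A) (i : Fin n) : Aˣ where
  val := coeff e i
  inv := coeff e⁻¹ (perm e i)
  val_inv := by rw [← coeff_mul, inv_mul_cancel, coeff_one]
  inv_val := by rw [mul_comm, ← coeff_mul, inv_mul_cancel, coeff_one]

theorem unitCoeff_mul (e f : actAut n A) (i : Fin n) :
    unitCoeff (e * f) i = unitCoeff f i * unitCoeff e (perm f i) :=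
  Units.ext (coeff_mul e f i)

/-- The automorphism of a free set with given permutation and coefficients. -/
def mk (σ : Equiv.Perm (Fin n)) (t : Fin n → Aˣ) : actAut n A where
  val :=
    { toFun := fun x => ⟨σ x.1, x.2 * t x.1⟩
      invFun := fun x => ⟨σ⁻¹ x.1, x.2 * ↑(t (σ⁻¹ x.1))⁻¹⟩
      left_inv := fun x => by simp
      right_inv := fun x => by simp }
  property a x := Sigma.ext rfl (heq_of_eq (mul_assoc _ _ _))

theorem perm_mk (σ : Equiv.Perm (Fin n)) (t : Fin n → Aˣ) : perm (mk σ t) = σ := rfl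

theorem unitCoeff_mk (σ : Equiv.Perm (Fin n)) (t : Fin n → Aˣ) : unitCoeff (mk σ t) = t :=
  funext fun i => Units.ext (one_mul (t i : A))

/-- By equivariance, an automorphism is determined by the images of the basis elements. -/
theorem mk_perm_unitCoeff (e : actAut n A) : mk (perm e) (unitCoeff e) = e := by
  apply Subtype.ext
  apply Equiv.ext
  rintro ⟨i, a⟩
  exact (apply_mk e i a).symm

variable {B : Type u} [CommMonoid B] (φ : A →* B)

/-- Invariance of the permutation under extension of scalars is what splits `GL_n` into components
as a presheaf. -/
theorem perm_map (e : actAut n A) : perm (actAut.map n φ e) = perm e := rfl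

theorem unitCoeff_map (e : actAut n A) (i : Fin n) :
    unitCoeff (actAut.map n φ e) i = Units.map φ (unitCoeff e i) :=
  Units.ext (one_mul (φ (coeff e i)))

theorem map_mk (σ : Equiv.Perm (Fin n)) (t : Fin n → Aˣ) :
    actAut.map n φ (mk σ t) = mk σ fun i => Units.map φ (t i) := by
  rw [← mk_perm_unitCoeff (actAut.map n φ (mk σ t)), perm_map, perm_mk]
  congr 1
  funext i
  rw [unitCoeff_map, unitCoeff_mk]

end actAut

/-! ### Identities are flat -/

section FlatId

/-- `A ⊗_A X = X`. -/
def actExtendId (A : Type u) [CommMonoid A] : actExtend (MonoidHom.id A) ≅ 𝟭 _ :=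
  NatIso.ofComponents (fun X => Action.mkIso (Equiv.toIso
    { toFun := Quot.lift (fun p => X.ρ p.1 p.2) (by
        rintro _ _ ⟨a, b, x, rfl, rfl⟩
        exact ConcreteCategory.congr_hom (map_mul X.ρ b a) x)
      invFun := fun x => Quot.mk _ (1, x)
      left_inv := by
        rintro ⟨b, x⟩
        exact (actTensor_mk_eq (MonoidHom.id A) X b 1 x).symm.trans
          (congrArg (fun z => (Quot.mk _ (z, x) : ActTensor (MonoidHom.id A) X)) (one_mul b))
      right_inv := fun x => ConcreteCategory.congr_hom (map_one X.ρ) x }) fun a => by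
        ext z
        obtain ⟨b, x⟩ := z
        exact ConcreteCategory.congr_hom (map_mul X.ρ a b) x) fun {X Y} f => by
    ext z
    obtain ⟨b, x⟩ := z
    exact (ConcreteCategory.congr_hom (f.comm b) x).symm

theorem modulesF_isFlat_id (A : CommMonCat.{u}) : modulesF.IsFlat (𝟙 A) :=
  have : PreservesFiniteLimits (𝟭 (Action (Type u) A)) :=
    PreservesLimitsOfSize.preservesFiniteLimits.{u, u} _
  show PreservesFiniteLimits (actExtend (MonoidHom.id A)) from
    preservesFiniteLimits_of_natIso (actExtendId A).symm

theorem modulesZ_isFlat_id (A : CommRingCat.{u}) : modulesZ.IsFlat (𝟙 A) :=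
  have : PreservesFiniteLimits (𝟭 (ModuleCat.{u} A)) :=
    PreservesLimitsOfSize.preservesFiniteLimits.{u, u} _
  show PreservesFiniteLimits (ModuleCat.extendScalars.{u, u, u} (RingHom.id A)) from
    preservesFiniteLimits_of_natIso (ModuleCat.extendScalarsId.{u, u} A).symm

end FlatId

/-! ### `GL_n` over 𝔽₁ is a scheme -/

section Scheme

/-- The monoid representing `𝔾_m^n` over `𝔽₁`. -/
abbrev TorusMonoid (n : ℕ) : Type u := ULift.{u} (Abelianization (FreeGroup (Fin n)))

/-- The points of `𝔾_m^n` over `𝔽₁`. -/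
def torusHomEquiv (n : ℕ) (A : Type u) [CommMonoid A] :
    (TorusMonoid.{u} n →* A) ≃ (Fin n → Aˣ) where
  toFun f i := f.toHomUnits ⟨Abelianization.of (FreeGroup.of i)⟩
  invFun t := (Units.coeHom A).comp ((Abelianization.lift (FreeGroup.lift t)).comp
    MulEquiv.ulift.toMonoidHom)
  left_inv f := by
    ext ⟨x⟩
    have : (Abelianization.lift (FreeGroup.lift fun i =>
        f.toHomUnits ⟨Abelianization.of (FreeGroup.of i)⟩)) =
        f.toHomUnits.comp MulEquiv.ulift.symm.toMonoidHom := by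
      ext i
      simp
      rfl
    change ((Abelianization.lift _ x : Aˣ) : A) = _
    rw [this]
    rfl
  right_inv t := by
    funext i
    apply Units.ext
    change ((Abelianization.lift (FreeGroup.lift t) (Abelianization.of (FreeGroup.of i)) : Aˣ) : A) =
      t i
    simp

/-- The component of `GL_n` over `𝔽₁` indexed by a permutation. -/
def glFComponent (n : ℕ) (σ : Equiv.Perm (Fin n)) :
    specSheaf (CommMonCat.of (TorusMonoid.{u} n)) ⟶
      groupPresheaf (glF.{u} n) ⋙ forget GrpCat.{u + 1} where
  app T := ↾fun x => ULift.up (actAut.mk σ (torusHomEquiv n T.unop.unop x.down.unop.hom))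
  naturality T T' φ := by
    ext x
    refine congrArg ULift.up (Eq.trans ?_ (actAut.map_mk _ σ _).symm)
    refine congrArg (actAut.mk σ) (funext fun i => Units.ext rfl)

theorem mem_range_glFComponent_iff {n : ℕ} {σ : Equiv.Perm (Fin n)} {T : CommMonCat.{u}ᵒᵖᵒᵖ}
    (x : (groupPresheaf (glF.{u} n) ⋙ forget GrpCat.{u + 1}).obj T) :
    x ∈ (Subfunctor.range (glFComponent.{u} n σ)).obj T ↔
      actAut.perm (ULift.down.{u + 1, u} x : actAut n T.unop.unop) = σ := by
  constructor
  · rintro ⟨y, rfl⟩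
    exact actAut.perm_mk _ _
  · intro h
    refine ⟨⟨(CommMonCat.ofHom ((torusHomEquiv n T.unop.unop).symm
      (actAut.unitCoeff (ULift.down.{u + 1, u} x : actAut n T.unop.unop)))).op⟩, ?_⟩
    refine ULift.ext _ _ ?_
    refine Eq.trans ?_ (actAut.mk_perm_unitCoeff _)
    rw [h]
    exact congrArg (actAut.mk σ) ((torusHomEquiv n _).apply_symm_apply _)

/-- Each section lies in exactly one torus component, the one given by its permutation. The sieve of
a component over a section is therefore everything or empty, and both are open. -/
theorem isRelativeScheme_glF (n : ℕ) :
    IsRelativeScheme modulesF.{u} (groupPresheaf (glF.{u} n) ⋙ forget GrpCat.{u + 1}) := by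
  have hbot : modulesF.{u}.zariskiTopology = ⊥ := zarF_eq_bot
  have htop : ∀ (T : CommMonCat.{u}ᵒᵖ)
      (x : (groupPresheaf (glF.{u} n) ⋙ forget GrpCat.{u + 1}).obj (op T)),
      (Subfunctor.range (glFComponent.{u} n
        (actAut.perm (ULift.down.{u + 1, u} x : actAut n T.unop)))).sieveOfSection x = ⊤ :=
    fun T x => by
      ext Y f
      exact iff_of_true ((mem_range_glFComponent_iff _).mpr rfl) trivial
  refine ⟨by rw [hbot]; exact Presheaf.isSheaf_bot _, ULift (Equiv.Perm (Fin n)),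
    fun _ => CommMonCat.of (TorusMonoid.{u} n),
    fun σ => glFComponent n σ.down, fun σ => ⟨fun T x y h => ?_, fun X x => ?_⟩, fun T x => ?_⟩
  · have h' := congrArg (fun z => actAut.unitCoeff (ULift.down.{u + 1, u} z :
      actAut n T.unop.unop)) h
    have h'' : torusHomEquiv n T.unop.unop x.down.unop.hom =
      torusHomEquiv n T.unop.unop y.down.unop.hom :=
      (actAut.unitCoeff_mk _ _).symm.trans (h'.trans (actAut.unitCoeff_mk _ _))
    exact ULift.ext _ _ (Quiver.Hom.unop_inj
      (CommMonCat.hom_ext ((torusHomEquiv n T.unop.unop).injective h'')))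
  · change modulesF.IsZariskiOpenSieve
      ((Subfunctor.range (glFComponent.{u} n σ.down)).sieveOfSection x)
    by_cases h : actAut.perm (ULift.down.{u + 1, u} x : actAut n X.unop) = σ.down
    · rw [← h, htop]
      exact modulesF.isZariskiOpenSieve_top _ (modulesF_isFlat_id _)
    -- The empty sieve is the image of the empty family; it is already closed because the topology
    -- is trivial.
    · refine ⟨⊥, fun Y f hf => hf.elim, ?_⟩
      have hS : (Subfunctor.range (glFComponent.{u} n σ.down)).sieveOfSection x = ⊥ := by
        ext Y f
        exact iff_of_false (fun hf => h
          ((mem_range_glFComponent_iff (T := op Y) ((groupPresheaf (glF.{u} n) ⋙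
            forget GrpCat.{u + 1}).map f.op x)).mp hf)) id
      rw [hS, hbot, Sieve.generate_bot]
      symm
      ext Y f
      refine iff_of_false (fun hf => ?_) id
      have hf' : (⊥ : Sieve X).pullback f = ⊤ := hf
      exact (show ((⊥ : Sieve X).pullback f).arrows (𝟙 Y) from hf' ▸ trivial)
  · have h := le_iSup (fun σ : ULift.{u} (Equiv.Perm (Fin n)) =>
      (Subfunctor.range (glFComponent.{u} n σ.down)).sieveOfSection x)
      ⟨actAut.perm (ULift.down.{u + 1, u} x : actAut n T.unop)⟩
    rw [htop, top_le_iff] at h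
    rw [h]
    exact modulesF.zariskiTopology.top_mem T

end Scheme

/-! ### Localization of a semiring at an idempotent -/

/-- `φ : A → B` is the localization of a commutative semiring at an idempotent `e`. -/
structure IsIdempotentLocalization {A B : Type u} [CommSemiring A] [CommSemiring B] (e : A)
    (φ : A →+* B) : Prop where
  surjective : Function.Surjective φ
  map_eq_one : φ e = 1
  mul_eq_mul : ∀ {a b}, φ a = φ b → e * a = e * b

/-- The congruence inverting an idempotent. -/
def idempotentCon {A : Type u} [CommSemiring A] {e : A} (he : e * e = e) : RingCon A where
  r a b := e * a = e * b
  iseqv := ⟨fun _ => rfl, fun h => h.symm, fun h h' => h.trans h'⟩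
  add' {a b c d} h h' := by rw [mul_add, mul_add, h, h']
  mul' {a b c d} h h' := by
    rw [← he, mul_mul_mul_comm, h, h', mul_mul_mul_comm]

theorem isIdempotentLocalization_mk {A : Type u} [CommSemiring A] {e : A} (he : e * e = e) :
    IsIdempotentLocalization e (idempotentCon he).mk' where
  surjective := RingCon.mk'_surjective _
  map_eq_one := (RingCon.eq _).mpr (show e * e = e * 1 by rw [he, mul_one])
  mul_eq_mul h := (RingCon.eq _).mp h

namespace IsIdempotentLocalization

section

variable {A B : Type u} [CommSemiring A] [CommSemiring B] {e : A} {φ : A →+* B}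
  (h : IsIdempotentLocalization e φ)

include h

/-- The additive section of the localization at an idempotent. -/
noncomputable def sec : letI := φ.toAlgebra; B →ₗ[A] A :=
  letI := φ.toAlgebra
  have key : ∀ {b a}, φ a = b → e * Function.surjInv h.surjective b = e * a := fun hb =>
    h.mul_eq_mul ((Function.surjInv_eq h.surjective _).trans hb.symm)
  { toFun := fun b => e * Function.surjInv h.surjective b
    map_add' := fun b b' => by
      obtain ⟨a, rfl⟩ := h.surjective b
      obtain ⟨a', rfl⟩ := h.surjective b'
      rw [key rfl, key rfl, key (map_add φ a a'), mul_add]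
    map_smul' := fun c b => by
      obtain ⟨a, rfl⟩ := h.surjective b
      exact (key (map_mul φ c a)).trans (by rw [key rfl]; exact mul_left_comm e c a) }

theorem sec_apply (a : A) : h.sec (φ a) = e * a :=
  h.mul_eq_mul (Function.surjInv_eq h.surjective _)

theorem map_sec (b : B) : φ (h.sec b) = b := by
  obtain ⟨a, rfl⟩ := h.surjective b
  rw [sec_apply, map_mul, h.map_eq_one, one_mul]

/-- The projection of `B ⊗ M` to the summand `e M` of `M`. -/
noncomputable def proj (M : Type u) [AddCommMonoid M] [Module A M] :
    letI := φ.toAlgebra; B ⊗[A] M →ₗ[A] M :=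
  letI := φ.toAlgebra
  TensorProduct.lift ((LinearMap.lsmul A M).comp h.sec)

theorem proj_tmul {M : Type u} [AddCommMonoid M] [Module A M] (b : B) (m : M) :
    letI := φ.toAlgebra
    h.proj M (b ⊗ₜ[A] m) = h.sec b • m := rfl

theorem proj_one_tmul {M : Type u} [AddCommMonoid M] [Module A M] (m : M) :
    letI := φ.toAlgebra
    h.proj M ((1 : B) ⊗ₜ[A] m) = e • m := by
  rw [proj_tmul, ← map_one φ, sec_apply, mul_one]

theorem proj_naturality {M N : Type u} [AddCommMonoid M] [Module A M] [AddCommMonoid N]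
    [Module A N] (f : M →ₗ[A] N) :
    letI := φ.toAlgebra
    ∀ z : B ⊗[A] M, h.proj N (f.baseChange B z) = f (h.proj M z) := by
  let _ := φ.toAlgebra
  intro z
  induction z with
  | zero => simp
  | add x y hx hy => simp only [map_add, hx, hy]
  | tmul b m =>
    rw [LinearMap.baseChange_tmul, proj_tmul, proj_tmul, map_smul]

/-- Every `b` is the image of `h.sec b`, so it can be moved across the tensor: `B ⊗ M` consists of
the elements `1 ⊗ m`. -/
theorem one_tmul_proj (M : Type u) [AddCommMonoid M] [Module A M] :
    letI := φ.toAlgebra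
    ∀ z : B ⊗[A] M, (1 : B) ⊗ₜ[A] h.proj M z = z := by
  let _ := φ.toAlgebra
  intro z
  induction z with
  | zero => simp
  | add x y hx hy => rw [map_add, TensorProduct.tmul_add, hx, hy]
  | tmul b m =>
    rw [proj_tmul, ← TensorProduct.smul_tmul]
    congr 1
    exact (mul_one _).trans (h.map_sec b)

end

/-- Restriction of scalars for semimodules. -/
def _root_.semimoduleRestrict {A B : Type u} [CommSemiring A] [CommSemiring B] (φ : A →+* B) :
    SemimoduleCat.{u} B ⥤ SemimoduleCat.{u} A where
  obj N := letI := Module.compHom N φ; SemimoduleCat.of A N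
  map {N N'} f :=
    letI := Module.compHom N φ
    letI := Module.compHom N' φ
    SemimoduleCat.ofHom (X := N) (Y := N')
      { f.hom with map_smul' := fun a x => f.hom.map_smul (φ a) x }

/-- Extension of scalars along the localization at an idempotent is right adjoint to restriction
of scalars. -/
noncomputable def adjunction {A B : Type u} [CommSemiring A] [CommSemiring B] {e : A} {φ : A →+* B}
    (h : IsIdempotentLocalization e φ) : semimoduleRestrict φ ⊣ semimoduleExtend φ :=
  letI := φ.toAlgebra
  Adjunction.mkOfUnitCounit
    { unit :=
        { app := fun N =>
            letI := Module.compHom N φ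
            SemimoduleCat.ofHom (X := N) (Y := B ⊗[A] N)
              { toFun := fun x => (1 : B) ⊗ₜ[A] x
                map_add' := fun x y => TensorProduct.tmul_add _ _ _
                map_smul' := fun b x => by
                  obtain ⟨a, rfl⟩ := h.surjective b
                  change (1 : B) ⊗ₜ[A] (a • x) = (φ a * 1) ⊗ₜ[A] x
                  rw [← TensorProduct.smul_tmul]
                  rfl }
          naturality := fun N N' f => rfl }
      counit :=
        { app := fun M => SemimoduleCat.ofHom (X := B ⊗[A] M) (Y := M) (h.proj M)
          naturality := fun M N f => by
            ext z
            exact h.proj_naturality f.hom z }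
      left_triangle := by
        refine NatTrans.ext (funext fun N => SemimoduleCat.hom_ext (LinearMap.ext fun (x : N) => ?_))
        let _ := Module.compHom N φ
        refine (h.proj_one_tmul (M := N) (x : N)).trans ?_
        exact (congrArg (fun b : B => b • (x : N)) h.map_eq_one).trans (one_smul B (x : N))
      right_triangle := by
        refine NatTrans.ext (funext fun M =>
          SemimoduleCat.hom_ext (LinearMap.ext fun (z : B ⊗[A] M) => ?_))
        exact h.one_tmul_proj M z }

end IsIdempotentLocalization

namespace IsIdempotentLocalization

variable {A B : Type u} [CommSemiring A] [CommSemiring B] {e : A} {φ : A →+* B}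

/-- If `φ a = φ b` then `e * a = e * b`, and applying `f` with `f e = 1` gives `f a = f b`. -/
theorem exists_factor (h : IsIdempotentLocalization e φ) {C : Type u} [CommSemiring C]
    (f : A →+* C) (hf : f e = 1) : ∃ g : B →+* C, g.comp φ = f := by
  have key : ∀ {a b}, φ a = φ b → f a = f b := fun {a b} hab => by
    simpa [hf] using congrArg f (h.mul_eq_mul hab)
  have hs : ∀ a, φ (Function.surjInv h.surjective (φ a)) = φ a := fun a =>
    Function.surjInv_eq h.surjective _
  refine ⟨
    { toFun := fun b => f (Function.surjInv h.surjective b)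
      map_one' := ?_
      map_mul' := fun b b' => ?_
      map_zero' := ?_
      map_add' := fun b b' => ?_ }, RingHom.ext fun a => key (hs a)⟩
  · rw [← map_one φ, key (hs 1), map_one]
  · obtain ⟨a, rfl⟩ := h.surjective b
    obtain ⟨a', rfl⟩ := h.surjective b'
    rw [← map_mul, key (hs _), key (hs _), key (hs _), map_mul]
  · rw [← map_zero φ, key (hs 0), map_zero]
  · obtain ⟨a, rfl⟩ := h.surjective b
    obtain ⟨a', rfl⟩ := h.surjective b'
    rw [← map_add, key (hs _), key (hs _), key (hs _), map_add]

/-- Flatness holds because extension of scalars is here a right adjoint. Finite presentation holds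
because an algebra receives a map from `B` exactly when `e` becomes `1` in it, a single equation. -/
theorem isZariskiOpen (h : IsIdempotentLocalization e φ) :
    modulesN.IsZariskiOpen (CommSemiRingCat.ofHom φ) := by
  have hepi : Epi (CommSemiRingCat.ofHom φ) :=
    ConcreteCategory.epi_of_surjective _ h.surjective
  refine ⟨hepi, ?_, .of_epi _ fun J _ _ K c hc f => ?_⟩
  · have := h.adjunction.rightAdjoint_preservesLimits
    exact show PreservesFiniteLimits (semimoduleExtend φ) from
      PreservesLimitsOfSize.preservesFiniteLimits.{0, 0} _
  · let j₀ : J := (IsFiltered.nonempty (C := J)).some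
    have hw : ∀ {X : Under (CommSemiRingCat.of A)} (g : Under.mk (CommSemiRingCat.ofHom φ) ⟶ X),
        X.hom e = 1 := fun {X} g => by
      have := ConcreteCategory.congr_hom (Under.w g) e
      rw [← this]
      change g.right (φ e) = 1
      rw [h.map_eq_one, map_one]
    have hc' := isColimitOfPreserves (Under.forget _ ⋙ forget CommSemiRingCat.{u}) hc
    -- Filtered colimits are computed on underlying sets, so the equality of `e` and `1` in the
    -- colimit already holds at some stage `k`.
    have heq : (c.ι.app j₀).right ((K.obj j₀).hom e) = (c.ι.app j₀).right 1 := by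
      rw [map_one, ← hw f]
      exact ConcreteCategory.congr_hom (Under.w (c.ι.app j₀)) e
    obtain ⟨k, a, hk⟩ := (Types.FilteredColimit.isColimit_eq_iff' hc' _ _).mp heq
    have hk' : (K.obj k).hom e = 1 := by
      have h₁ : (K.map a).right ((K.obj j₀).hom e) = (K.map a).right 1 := hk
      rw [map_one] at h₁
      rw [← h₁]
      exact (ConcreteCategory.congr_hom (Under.w (K.map a)) e).symm
    obtain ⟨g, hg⟩ := h.exists_factor (K.obj k).hom.hom hk'
    exact ⟨k, ⟨Under.homMk (CommSemiRingCat.ofHom g) (CommSemiRingCat.hom_ext hg)⟩⟩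

end IsIdempotentLocalization

/-! ### Coverings by idempotents -/

section Cover

/-- Elements decompose as `x = ∑ e j • x`, and `e j • x` is the projection of `1 ⊗ x` in `B j ⊗ M`.
Injectivity and surjectivity are thus checked on the summands and reassembled by summation. -/
theorem jointlyConservative_of_idempotents {A : CommSemiRingCat.{u}} {J : Type} [Fintype J]
    {B : J → CommSemiRingCat.{u}} (φ : ∀ j, A ⟶ B j) (e : J → A) (he : ∑ j, e j = 1)
    (h : ∀ j, IsIdempotentLocalization (e j) (φ j).hom) : modulesN.JointlyConservative φ := by
  suffices key : ∀ (M N : SemimoduleCat.{u} A) (f : M ⟶ N),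
      (∀ j, IsIso ((semimoduleExtend (φ j).hom).map f)) → IsIso f from
    fun M N f hf => key M N f hf
  intro M N f hf
  let g : M →ₗ[A] N := f.hom
  have hb : ∀ j, letI := (φ j).hom.toAlgebra; Function.Bijective (g.baseChange (B j)) :=
    fun j => (SemimoduleCat.isIso_iff_bijective _).mp (hf j)
  refine (SemimoduleCat.isIso_iff_bijective f).mpr ⟨fun x y hxy => ?_, fun y => ?_⟩
  · have hj : ∀ j, e j • x = e j • y := fun j => by
      let _ := (φ j).hom.toAlgebra
      rw [← (h j).proj_one_tmul, ← (h j).proj_one_tmul]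
      congr 1
      apply (hb j).1
      rw [LinearMap.baseChange_tmul, LinearMap.baseChange_tmul]
      exact congrArg _ hxy
    rw [← one_smul A x, ← one_smul A y, ← he, Finset.sum_smul, Finset.sum_smul]
    exact Finset.sum_congr rfl fun j _ => hj j
  · have hj : ∀ j, ∃ x, g x = e j • y := fun j => by
      let _ := (φ j).hom.toAlgebra
      obtain ⟨z, hz⟩ := (hb j).2 ((1 : B j) ⊗ₜ[A] y)
      refine ⟨(h j).proj _ z, ?_⟩
      rw [← (h j).proj_naturality, hz, (h j).proj_one_tmul]
    choose x hx using hj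
    refine ⟨∑ j, x j, ?_⟩
    change g (∑ j, x j) = y
    rw [map_sum, Finset.sum_congr rfl fun j _ => hx j, ← Finset.sum_smul, he, one_smul]

/-- Localizations at idempotents with sum `1` form a covering. -/
theorem mem_zarN_of_idempotents {A : CommSemiRingCat.{u}} {J : Type} [Fintype J]
    {B : J → CommSemiRingCat.{u}} (φ : ∀ j, A ⟶ B j) (e : J → A) (he : ∑ j, e j = 1)
    (h : ∀ j, IsIdempotentLocalization (e j) (φ j).hom) (S : Sieve (op A))
    (hS : ∀ j, S (φ j).op) : S ∈ zarN.{u} (op A) := by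
  have hR : modulesN.IsZariskiCovering
      (Presieve.ofArrows (fun j => op (B j)) fun j => (φ j).op) := by
    refine ⟨?_, Fintype.card J, fun i => op (B ((Fintype.equivFin J).symm i)),
      fun i => (φ ((Fintype.equivFin J).symm i)).op, fun i => ⟨_⟩, ?_⟩
    · rintro _ _ ⟨j⟩
      exact (h j).isZariskiOpen
    · exact jointlyConservative_of_idempotents _ (fun i => e ((Fintype.equivFin J).symm i))
        ((Equiv.sum_comp _ e).trans he) fun i => h _
  refine zarN.superset_covering ?_ (Precoverage.generate_mem_toGrothendieck hR)
  rw [Sieve.generate_le_iff]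
  rintro _ _ ⟨j⟩
  exact hS j

end Cover

/-! ### From monomial automorphisms to 𝔾_m^n ⋊ Σ_n -/

section MonomialToSemidirect

/-- The automorphisms of a free set over the multiplicative monoid of a semiring, as points of
`𝔾_m^n ⋊ Σ_n`. -/
noncomputable def actAut.toSemidirect (n : ℕ) (A : Type u) [CommSemiring A] :
    actAut n A →* SemiringSemidirectPoints n A where
  -- Coefficients are indexed by the target of each basis vector, to match the action `i ↦ t (σ⁻¹
  -- i)`.
  toFun e := ⟨fun i => unitCoeff e ((perm e)⁻¹ i), .const A (perm e)⟩
  map_one' := by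
    refine SemidirectProduct.ext ?_ ?_
    · funext i
      exact Units.ext (coeff_one (n := n) (A := A) i)
    · exact congrArg (SemiringConstGroup.const A) (map_one perm)
  map_mul' e f := by
    refine SemidirectProduct.ext ?_ ?_
    · have h : ∀ t : Fin n → Aˣ, MulDistribMulAction.toMulAut
          (SemiringConstGroup (Equiv.Perm (Fin n)) A) (Fin n → Aˣ) (.const A (perm e)) t =
          fun i => t ((perm e)⁻¹ i) := SemiringConstGroup.permute_const (perm e)
      rw [SemidirectProduct.mul_left, h]
      funext i
      change unitCoeff (e * f) ((perm (e * f))⁻¹ i) =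
        unitCoeff e ((perm e)⁻¹ i) * unitCoeff f ((perm f)⁻¹ ((perm e)⁻¹ i))
      rw [unitCoeff_mul, map_mul, mul_inv_rev, Equiv.Perm.mul_apply, mul_comm]
      congr 2
      exact (perm f).apply_symm_apply _
    · rw [SemidirectProduct.mul_right, map_mul]
      exact SemiringConstGroup.const_mul _ _

theorem actAut.toSemidirect_map {n : ℕ} {A B : CommSemiRingCat.{u}} (φ : A ⟶ B) (e : actAut n A) :
    actAut.toSemidirect n B (actAut.map n φ.hom.toMonoidHom e) =
      (semidirectN n).map φ (actAut.toSemidirect n A e) := by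
  refine SemidirectProduct.ext ?_ ?_
  · funext i
    exact actAut.unitCoeff_map _ _ _
  · exact (SemiringConstGroup.map_const φ.hom _).symm

/-- The morphism from the restriction of `GL_{n,𝔽₁}` to commutative semirings to `𝔾_m^n ⋊ Σ_n`. -/
noncomputable def glFToSemidirect (n : ℕ) :
    (forget₂ CommSemiRingCat.{u} CommMonCat.{u}).op.op ⋙ groupPresheaf (glF.{u} n) ⟶
      groupPresheaf (semidirectN.{u} n) where
  app A := GrpCat.ofHom (MulEquiv.ulift.symm.toMonoidHom.comp
    ((actAut.toSemidirect n A.unop.unop).comp MulEquiv.ulift.toMonoidHom))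
  naturality A B φ := by
    ext x
    exact congrArg ULift.up (actAut.toSemidirect_map φ.unop.unop x.down)

/-- Equal images with equal permutations force equal coefficients. With distinct permutations, two
different constant families coincide, so `0 = 1` in the semiring. -/
instance (n : ℕ) : Presheaf.IsLocallyInjective zarN.{u} (glFToSemidirect.{u} n) where
  equalizerSieve_mem {X} x y h := by
    have h' : actAut.toSemidirect n X.unop.unop x.down = actAut.toSemidirect n X.unop.unop y.down :=
      congrArg ULift.down h
    by_cases hp : actAut.perm (ULift.down x : actAut n X.unop.unop) =
      actAut.perm (ULift.down y : actAut n X.unop.unop)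
    · have hxy : x = y := by
        refine ULift.ext _ _ ?_
        rw [← actAut.mk_perm_unitCoeff x.down, ← actAut.mk_perm_unitCoeff y.down, hp]
        congr 1
        funext i
        have h₁ := congrFun (congrArg SemidirectProduct.left h')
          (actAut.perm (ULift.down y : actAut n X.unop.unop) i)
        change actAut.unitCoeff _ ((actAut.perm _)⁻¹ _) =
          actAut.unitCoeff _ ((actAut.perm _)⁻¹ _) at h₁
        rw [hp] at h₁
        simpa using h₁
      subst hxy
      rw [Presheaf.equalizerSieve_self_eq_top]
      exact zarN.top_mem _
    · have h₁ := congrFun (congrArg (fun z => SemiringConstGroup.fam (SemidirectProduct.right z)) h')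
        (actAut.perm (ULift.down x : actAut n X.unop.unop))
      have h₀ : (0 : (X.unop.unop : Type u)) = 1 := by
        classical
        change (SemiringConstGroup.const _ _).fam _ = (SemiringConstGroup.const _ _).fam _ at h₁
        rw [SemiringConstGroup.const_apply, SemiringConstGroup.const_apply, if_pos rfl,
          if_neg hp] at h₁
        exact h₁.symm
      -- The empty sum equals `1` here: the zero semiring is covered by the empty family, so any two
      -- sections over it are locally equal.
      exact mem_zarN_of_idempotents (A := X.unop.unop) (J := Empty) (B := fun j => j.elim)
        (fun j => j.elim) (fun j => j.elim) (by simpa using h₀) (fun j => j.elim) _ fun j => j.elim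

/-- On the localization at the idempotent with index `σ`, the family becomes constant with value
`σ`, and the point comes from the monomial automorphism with that permutation. -/
instance (n : ℕ) : Presheaf.IsLocallySurjective zarN.{u} (glFToSemidirect.{u} n) where
  imageSieve_mem {X} s := by
    let A : CommSemiRingCat.{u} := X.unop
    let x : SemiringSemidirectPoints n A := ULift.down s
    let φ : ∀ σ : Equiv.Perm (Fin n),
        A ⟶ CommSemiRingCat.of (idempotentCon (x.right.fam_mul_self σ)).Quotient := fun σ =>
      CommSemiRingCat.ofHom (idempotentCon (x.right.fam_mul_self σ)).mk'
    have hφ : ∀ σ, IsIdempotentLocalization (x.right.fam σ) (φ σ).hom := fun σ =>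
      isIdempotentLocalization_mk _
    refine mem_zarN_of_idempotents φ x.right.fam x.right.sum_eq_one hφ _ fun σ => ?_
    refine ⟨ULift.up (actAut.mk σ fun i => Units.map (φ σ).hom.toMonoidHom (x.left (σ i))), ?_⟩
    refine congrArg ULift.up (SemidirectProduct.ext (funext fun i => ?_) ?_)
    · change actAut.unitCoeff _ (σ⁻¹ i) = Units.map (φ σ).hom.toMonoidHom (x.left i)
      refine (congrFun (actAut.unitCoeff_mk σ _) (σ⁻¹ i)).trans ?_
      exact congrArg (fun j => Units.map (φ σ).hom.toMonoidHom (x.left j)) (σ.apply_symm_apply i)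
    · exact (SemiringConstGroup.eq_const (SemiringConstGroup.map _ (φ σ).hom x.right)
        (hφ σ).map_eq_one).symm

end MonomialToSemidirect

/-! ### Computation of the base changes -/

section BaseChange

/-- The morphism from a base change induced by a morphism of presheaves that becomes invertible on
associated sheaves is an isomorphism. -/
theorem isIso_sheafBaseChangeDesc {𝓒 𝓓 : Type (u + 1)} [Category.{u} 𝓒] [Category.{u} 𝓓]
    (g : 𝓓 ⥤ 𝓒) {J : GrothendieckTopology 𝓒ᵒᵖ} {K : GrothendieckTopology 𝓓ᵒᵖ}
    {E : Type w} [Category.{v} E] [HasWeakSheafify K E] {P : Sheaf J E} {Q : Sheaf K E}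
    (α : g.op.op ⋙ P.obj ⟶ Q.obj) (hα : K.W α) : IsIso (sheafBaseChangeDesc g α) := by
  have : IsIso ((presheafToSheaf K E).map α) := (K.W_iff α).1 hα
  change IsIso (((sheafificationAdjunction K E).homEquiv _ _).symm α)
  -- The transpose of `α` is its sheafification followed by the counit, which is invertible at a
  -- sheaf.
  rw [Adjunction.homEquiv_counit]
  infer_instance

theorem isIso_sheafBaseChangeDesc_of_isIso {𝓒 𝓓 : Type (u + 1)} [Category.{u} 𝓒] [Category.{u} 𝓓]
    (g : 𝓓 ⥤ 𝓒) {J : GrothendieckTopology 𝓒ᵒᵖ} {K : GrothendieckTopology 𝓓ᵒᵖ}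
    {E : Type w} [Category.{v} E] [HasWeakSheafify K E] {P : Sheaf J E} {Q : Sheaf K E}
    (α : g.op.op ⋙ P.obj ⟶ Q.obj) (_ : IsIso α) : IsIso (sheafBaseChangeDesc g α) :=
  isIso_sheafBaseChangeDesc g α (MorphismProperty.of_isIso _ _)

instance (n : ℕ) : IsIso (glNToGlZ.{u} n) :=
  have : ∀ A, IsIso ((glNToGlZ.{u} n).app A) := fun A =>
    inferInstanceAs (IsIso (𝟙 (GrpCat.of (ULift.{u + 1} (LinAut n A.unop.unop)))))
  NatIso.isIso_of_isIso_app _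

/-- If `P` becomes isomorphic to `R` over `ℕ` after sheafification, and `R` restricts to `Q`, then
the base change of `P` to `ℤ` is `Q`. -/
theorem nonempty_baseChangeFZ_iso {E : Type w} [Category.{v} E] [HasWeakSheafify zarN.{u} E]
    [HasWeakSheafify zarZ.{u} E] (P : Sheaf zarF.{u} E) (R : Sheaf zarN.{u} E) (Q : Sheaf zarZ.{u} E)
    (α : (forget₂ CommSemiRingCat.{u} CommMonCat.{u}).op.op ⋙ P.obj ⟶ R.obj) (hα : zarN.W α)
    (β : (forget₂ CommRingCat.{u} CommSemiRingCat.{u}).op.op ⋙ R.obj ≅ Q.obj) :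
    Nonempty (((baseChangeFZ E).obj P).obj ≅ Q.obj) := by
  let a : (baseChangeFN E).obj P ⟶ R := sheafBaseChangeDesc _ α
  let b : (baseChangeNZ E).obj R ⟶ Q := sheafBaseChangeDesc _ β.hom
  have : IsIso a := isIso_sheafBaseChangeDesc _ α hα
  have : IsIso b := isIso_sheafBaseChangeDesc_of_isIso _ β.hom inferInstance
  exact ⟨(sheafToPresheaf _ _).mapIso ((baseChangeNZ E).mapIso (asIso a) ≪≫ asIso b)⟩

theorem nonempty_baseChangeFZ_glF_iso (n : ℕ)
    (hF : Presheaf.IsSheaf zarF.{u} (groupPresheaf (glF.{u} n))) :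
    Nonempty (((baseChangeFZ GrpCat.{u + 1}).obj ⟨groupPresheaf (glF.{u} n), hF⟩).obj ≅
      groupPresheaf (semidirectZ.{u} n)) :=
  nonempty_baseChangeFZ_iso _
    ⟨groupPresheaf (semidirectN n),
      isSheaf_group_of_forget _ _ (isAffineScheme_semidirectN n).isSheaf_zarN⟩
    ⟨groupPresheaf (semidirectZ n),
      isSheaf_group_of_forget _ _ (isAffineScheme_semidirectZ n).isSheaf_zarZ⟩
    (glFToSemidirect n) (zarN.W_of_isLocallyBijective _) (semidirectNIso n)

theorem nonempty_baseChangeFZ_glF_forget_iso (n : ℕ)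
    (hF : Presheaf.IsSheaf zarF.{u} (groupPresheaf (glF.{u} n) ⋙ forget GrpCat.{u + 1})) :
    Nonempty (((baseChangeFZ (Type (u + 1))).obj
        ⟨groupPresheaf (glF.{u} n) ⋙ forget GrpCat.{u + 1}, hF⟩).obj ≅
      groupPresheaf (semidirectZ.{u} n) ⋙ forget GrpCat.{u + 1}) :=
  nonempty_baseChangeFZ_iso _
    ⟨groupPresheaf (semidirectN n) ⋙ forget _, (isAffineScheme_semidirectN n).isSheaf_zarN⟩
    ⟨groupPresheaf (semidirectZ n) ⋙ forget _, (isAffineScheme_semidirectZ n).isSheaf_zarZ⟩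
    (Functor.whiskerRight (glFToSemidirect n) (forget GrpCat.{u + 1}))
    (zarN.W_of_isLocallyBijective (Functor.whiskerRight (glFToSemidirect n) (forget GrpCat.{u + 1})))
    (Functor.isoWhiskerRight (semidirectNIso n) (forget GrpCat.{u + 1}))

end BaseChange

/-! ### Groups of points -/

section Points

/-- Invertible matrices of natural numbers are permutation matrices. -/
theorem exists_perm_of_mul_eq_one {n : Type*} [Fintype n] [DecidableEq n] {M N : Matrix n n ℕ}
    (hMN : M * N = 1) (hNM : N * M = 1) :
    ∃ σ : Equiv.Perm n, ∀ i j, M i j = if i = σ j then 1 else 0 := by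
  have hle : ∀ (P Q : Matrix n n ℕ) (i j k : n), P i k * Q k j ≤ (P * Q) i j := fun P Q i j k => by
    rw [Matrix.mul_apply]
    exact Finset.single_le_sum (f := fun k => P i k * Q k j) (fun _ _ => Nat.zero_le _)
      (Finset.mem_univ k)
  -- The diagonal entries of `N * M` are `1`, so some term of each sum is nonzero; its index becomes
  -- the image of `j`.
  have hex : ∀ j, ∃ k, N j k * M k j ≠ 0 := fun j => by
    by_contra! h
    have h₁ : (N * M) j j = 0 := by
      rw [Matrix.mul_apply]
      exact Finset.sum_eq_zero fun k _ => h k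
    rw [hNM, Matrix.one_apply_eq] at h₁
    exact one_ne_zero h₁
  choose s hs using hex
  have hN : ∀ j, N j (s j) ≠ 0 := fun j => left_ne_zero_of_mul (hs j)
  have hM : ∀ j, M (s j) j ≠ 0 := fun j => right_ne_zero_of_mul (hs j)
  -- If `s j = s j'` with `j ≠ j'`, a product of nonzero entries would be bounded by an off-diagonal
  -- entry of `N * M`, which is zero.
  have hinj : Function.Injective s := fun j j' h => by
    by_contra hne
    have := hle N M j j' (s j)
    rw [hNM, Matrix.one_apply_ne hne, Nat.le_zero] at this
    rcases mul_eq_zero.1 this with h' | h'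
    · exact hN j h'
    · exact hM j' (h ▸ h')
  refine ⟨Equiv.ofBijective s (Finite.injective_iff_bijective.1 hinj), fun i j => ?_⟩
  -- Since `N j (s j)` is nonzero, the bound by the entry `(i, s j)` of the identity matrix leaves
  -- only `0` or `1` for `M i j`.
  have := hle M N i (s j) j
  rw [Equiv.ofBijective_apply]
  split_ifs with h
  · subst h
    rw [hMN, Matrix.one_apply_eq] at this
    exact Nat.eq_one_of_mul_eq_one_right
      (le_antisymm this (Nat.one_le_iff_ne_zero.2 (mul_ne_zero (hM j) (hN j))))
  · rw [hMN, Matrix.one_apply_ne h, Nat.le_zero] at this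
    exact (mul_eq_zero.1 this).resolve_right (hN j)

/-- The linear automorphism permuting the standard basis. -/
def LinAut.ofPerm (n : ℕ) (A : Type u) [CommSemiring A] : Equiv.Perm (Fin n) →* LinAut n A where
  toFun σ := LinearMap.GeneralLinearGroup.ofLinearEquiv (LinearEquiv.funCongrLeft A A σ.symm)
  map_one' := Units.ext rfl
  map_mul' _ _ := Units.ext rfl

theorem LinAut.ofPerm_single (n : ℕ) (A : Type u) [CommSemiring A] (σ : Equiv.Perm (Fin n))
    (i : Fin n) : (LinAut.ofPerm n A σ).1 (Pi.single i 1) = Pi.single (σ i) 1 := by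
  funext j
  change (Pi.single i 1 : Fin n → A) (σ.symm j) = _
  simp only [Pi.single_apply, Equiv.symm_apply_eq]

/-- Injectivity is tested on basis vectors, which needs `0 ≠ 1`; surjectivity is the statement on
invertible matrices over ℕ, moved through the universe lift. -/
theorem LinAut.ofPerm_bijective (n : ℕ) : Function.Bijective (LinAut.ofPerm n (ULift.{u} ℕ)) := by
  constructor
  · intro σ τ h
    ext i : 1
    have h₁ := ofPerm_single n (ULift.{u} ℕ) σ i
    rw [h, ofPerm_single] at h₁
    by_contra hne
    have h₂ := congrFun h₁ (σ i)
    rw [Pi.single_eq_same, Pi.single_eq_of_ne hne] at h₂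
    exact zero_ne_one h₂
  · intro e
    let g : (Matrix (Fin n) (Fin n) ℕ)ˣ := Units.map
      (ULift.ringEquiv (R := ℕ)).toRingHom.mapMatrix.toMonoidHom (linAutEquiv n (ULift.{u} ℕ) e)
    obtain ⟨σ, hσ⟩ := exists_perm_of_mul_eq_one g.mul_inv g.inv_mul
    refine ⟨σ, Units.ext ((Pi.basisFun _ _).ext fun j => ?_)⟩
    rw [Pi.basisFun_apply, ofPerm_single]
    funext i
    have h : (e.1 (Pi.single j 1) i).down = if i = σ j then 1 else 0 := by
      refine Eq.trans ?_ (hσ i j)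
      change _ = (LinearMap.toMatrixAlgEquiv' e.1 i j).down
      rw [LinearMap.toMatrixAlgEquiv'_apply]
    refine ULift.ext _ _ ?_
    rw [h, Pi.single_apply]
    split_ifs <;> rfl

theorem exists_mulEquiv_pointsAt_glZ (n : ℕ) :
    ∃ e : Matrix.GeneralLinearGroup (Fin n) ℤ ≃* pointsAt (groupPresheaf (glZ.{u} n)) baseZ.{u},
      ∀ (g : Matrix.GeneralLinearGroup (Fin n) ℤ) (i j : Fin n),
        ((ULift.down.{u + 1, u} (e g) : LinAut n (ULift.{u} ℤ)).1 (Pi.single j 1) i).down =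
          g.1 i j := by
  refine ⟨((Units.mapEquiv ((ULift.ringEquiv : ULift.{u} ℤ ≃+* ℤ).symm.mapMatrix).toMulEquiv).trans
    (linAutEquiv n (ULift.{u} ℤ)).symm).trans MulEquiv.ulift.symm, fun g i j => ?_⟩
  change ULift.down (Matrix.toLinAlgEquiv' (g.1.map ULift.up) (Pi.single j 1) i) = _
  simp

theorem exists_mulEquiv_pointsAt_glN (n : ℕ) :
    ∃ e : Equiv.Perm (Fin n) ≃* pointsAt (groupPresheaf (glN.{u} n)) baseN.{u},
      ∀ (σ : Equiv.Perm (Fin n)) (i : Fin n),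
        (ULift.down.{u + 1, u} (e σ) : LinAut n (ULift.{u} ℕ)).1 (Pi.single i 1) =
          Pi.single (σ i) 1 :=
  ⟨(MulEquiv.ofBijective _ (LinAut.ofPerm_bijective n)).trans MulEquiv.ulift.symm,
    LinAut.ofPerm_single n _⟩

/-- Over the one-point monoid all coefficients are trivial, so an automorphism is only its
permutation. -/
theorem exists_mulEquiv_pointsAt_glF (n : ℕ) :
    ∃ e : Equiv.Perm (Fin n) ≃* pointsAt (groupPresheaf (glF.{u} n)) baseF.{u},
      ∀ (σ : Equiv.Perm (Fin n)) (i : Fin n),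
        (ULift.down.{u + 1, u} (e σ) : actAut n PUnit.{u + 1}).1 ⟨i, 1⟩ = ⟨σ i, 1⟩ := by
  have h : Function.Bijective (actAut.perm (n := n) (A := PUnit.{u + 1})) :=
    ⟨fun e f hef => by
      rw [← actAut.mk_perm_unitCoeff e, ← actAut.mk_perm_unitCoeff f, hef,
        Subsingleton.elim (actAut.unitCoeff e) (actAut.unitCoeff f)],
      fun σ => ⟨actAut.mk σ 1, rfl⟩⟩
  refine ⟨(MulEquiv.ofBijective _ h).symm.trans MulEquiv.ulift.symm, fun σ i => ?_⟩
  refine Sigma.ext ?_ (heq_of_eq (Subsingleton.elim _ _))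
  exact congrFun (congrArg DFunLike.coe ((MulEquiv.ofBijective _ h).apply_symm_apply σ)) i

end Points

/-! ### The main theorem -/

theorem mainTheorem6 (n : ℕ) :
    -- the three functors are sheaves of groups for the Zariski topologies
    ∃ (hZ : Presheaf.IsSheaf zarZ.{u} (groupPresheaf (glZ.{u} n)))
      (hN : Presheaf.IsSheaf zarN.{u} (groupPresheaf (glN.{u} n)))
      (hF : Presheaf.IsSheaf zarF.{u} (groupPresheaf (glF.{u} n))),
    let GLZ : Sheaf zarZ.{u} GrpCat.{u + 1} := ⟨groupPresheaf (glZ.{u} n), hZ⟩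
    let GLN : Sheaf zarN.{u} GrpCat.{u + 1} := ⟨groupPresheaf (glN.{u} n), hN⟩
    let GLF : Sheaf zarF.{u} GrpCat.{u + 1} := ⟨groupPresheaf (glF.{u} n), hF⟩
    -- the underlying sheaves of sets
    let GLZ' : Sheaf zarZ.{u} (Type (u + 1)) := (sheafCompose _ (forget GrpCat.{u + 1})).obj GLZ
    let GLN' : Sheaf zarN.{u} (Type (u + 1)) := (sheafCompose _ (forget GrpCat.{u + 1})).obj GLN
    let GLF' : Sheaf zarF.{u} (Type (u + 1)) := (sheafCompose _ (forget GrpCat.{u + 1})).obj GLF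
    -- (1) representability
    (IsAffineScheme GLZ'.obj ∧ IsAffineScheme GLN'.obj ∧ IsRelativeScheme modulesF.{u} GLF'.obj) ∧
    -- (2) the natural morphism `GL_{n,ℕ} ⊗_ℕ ℤ ⟶ GL_{n,ℤ}` is an isomorphism,
    -- for the sheaves of sets and for the sheaves of groups
    (IsIso (sheafBaseChangeDesc (P := GLN') (Q := GLZ')
        (forget₂ CommRingCat.{u} CommSemiRingCat.{u})
        (Functor.whiskerRight (glNToGlZ.{u} n) (forget GrpCat.{u + 1})) :
        (baseChangeNZ (Type (u + 1))).obj GLN' ⟶ GLZ') ∧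
      IsIso (sheafBaseChangeDesc (P := GLN) (Q := GLZ)
        (forget₂ CommRingCat.{u} CommSemiRingCat.{u}) (glNToGlZ.{u} n) :
        (baseChangeNZ GrpCat.{u + 1}).obj GLN ⟶ GLZ)) ∧
    -- (3) `GL_{n,𝔽₁} ⊗_{𝔽₁} ℤ` is a scheme, isomorphic to the semidirect product of `Σ_n`
    -- and `𝔾_m^n`, as a sheaf of sets and as a sheaf of groups
    (IsRelativeScheme modulesZ.{u} ((baseChangeFZ (Type (u + 1))).obj GLF').obj ∧
      Nonempty (((baseChangeFZ (Type (u + 1))).obj GLF').obj ≅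
        groupPresheaf (semidirectZ.{u} n) ⋙ forget GrpCat.{u + 1}) ∧
      Nonempty (((baseChangeFZ GrpCat.{u + 1}).obj GLF).obj ≅
        groupPresheaf (semidirectZ.{u} n))) ∧
    -- (4) the groups of points: `GL_{n,ℤ}(ℤ)` is the group of invertible integral matrices, and
    -- `GL_{n,ℕ}(ℕ)`, `GL_{n,𝔽₁}(𝔽₁)` are the group of permutations of the standard basis
    ((∃ e : Matrix.GeneralLinearGroup (Fin n) ℤ ≃* pointsAt GLZ.obj baseZ.{u},
        ∀ (g : Matrix.GeneralLinearGroup (Fin n) ℤ) (i j : Fin n),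
          ((ULift.down.{u + 1, u} (e g) : LinAut n (ULift.{u} ℤ)).1 (Pi.single j 1) i).down =
            g.1 i j) ∧
      (∃ e : Equiv.Perm (Fin n) ≃* pointsAt GLN.obj baseN.{u},
        ∀ (σ : Equiv.Perm (Fin n)) (i : Fin n),
          (ULift.down.{u + 1, u} (e σ) : LinAut n (ULift.{u} ℕ)).1 (Pi.single i 1) =
            Pi.single (σ i) 1) ∧
      (∃ e : Equiv.Perm (Fin n) ≃* pointsAt GLF.obj baseF.{u},
        ∀ (σ : Equiv.Perm (Fin n)) (i : Fin n),
          (ULift.down.{u + 1, u} (e σ) : actAut n PUnit.{u + 1}).1 ⟨i, 1⟩ = ⟨σ i, 1⟩)) := by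
  have hZ := isAffineScheme_glZ.{u} n
  have hN := isAffineScheme_glN.{u} n
  have hF : Presheaf.IsSheaf zarF.{u} (groupPresheaf (glF.{u} n)) := by
    rw [zarF_eq_bot]
    exact Presheaf.isSheaf_bot _
  refine ⟨isSheaf_group_of_forget _ _ hZ.isSheaf_zarZ, isSheaf_group_of_forget _ _ hN.isSheaf_zarN,
    hF, ?_⟩
  intro GLZ GLN GLF GLZ' GLN' GLF'
  have hNZ : IsIso (Functor.whiskerRight (glNToGlZ.{u} n) (forget GrpCat.{u + 1})) :=
    inferInstanceAs (IsIso (((Functor.whiskeringRight _ _ _).obj (forget GrpCat.{u + 1})).map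
      (glNToGlZ.{u} n)))
  obtain ⟨i⟩ := nonempty_baseChangeFZ_glF_forget_iso.{u} n GLF'.property
  -- With `i`, this makes the base change of `GL_n` from 𝔽₁ to ℤ affine, and in particular a scheme.
  obtain ⟨A, ⟨j⟩⟩ := isAffineScheme_semidirectZ.{u} n
  exact ⟨⟨hZ, hN, isRelativeScheme_glF n⟩,
    ⟨isIso_sheafBaseChangeDesc_of_isIso (P := GLN') (Q := GLZ') _ _ hNZ,
      isIso_sheafBaseChangeDesc_of_isIso (P := GLN) (Q := GLZ) _ _ inferInstance⟩,
    ⟨.of_isAffineScheme modulesZ modulesZ_isFlat_id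
        ((baseChangeFZ (Type (u + 1))).obj GLF').property ⟨A, ⟨i ≪≫ j⟩⟩,
      ⟨i⟩, nonempty_baseChangeFZ_glF_iso n hF⟩,
    exists_mulEquiv_pointsAt_glZ n, exists_mulEquiv_pointsAt_glN n, exists_mulEquiv_pointsAt_glF n⟩
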